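/- For $L>0$ let $L^2_{\rm per}(0,L)$ be the space of complex-valued measurable functions on $\mathbb R$ of period $L$ that are square integrable on $[0,L]$ (functions equal almost everywhere are identified), with Fourier coefficients $\mathcal F_L u[n]=\frac1L\int_0^L e^{-2\pi i n x/L}u(x)\,dx$, $n\in\mathbb Z$. Let $T^L_t$ be the solution operator of $iv_t+v_{xx}=0$ with period $L$, i.e. $\mathcal F_L(T^L_tu)[n]=e^{-i(2\pi n/L)^2t}\,\mathcal F_Lu[n]$, and put $$H_L(u)=-\frac{2\pi}{L}\int_0^L\int_0^1|T^L_tu(x)|^4\,dt\,dx,\qquad P(u)=\frac12\int_0^L|u|^2\,dx .$$ For $\lambda>0$ let $S_{L,\lambda}$ be the set of all $\phi\in L^2_{\rm per}(0,L)$ that minimize $H_L$ subject to the constraint $P=\lambda$. For $B>0$ and $u\in L^2(\mathbb T)=L^2_{\rm per}(0,2\pi)$ with Fourier coefficients $\hat u(n)=\frac1{2\pi}\int_0^{2\pi}e^{-inx}u(x)\,dx$, put $$D_B(u)=2\pi\sum_{l\ne0}\sum_{n}\sum_{p\ne0}\hat u(n)\,\overline{\hat u(n-l)}\;\overline{\hat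 u(n-p)}\,\hat u(n-p-l)\int_0^Be^{-2ilpt}\,dt,\qquad A_B(u)=\frac{D_B(u)}{2\pi B}-\|\hat u\|_{\ell^4}^4 ,$$ where $l,n,p$ run over $\mathbb Z$. Let $L=\sqrt{8\pi}$, so that $B:=(2\pi/L)^2=\pi/2$. Then the integral defining $H_L(u)$ is finite for every $u\in L^2_{\rm per}(0,L)$, and for every $\lambda>0$ the set $S_{L,\lambda}$ is nonempty. However, for every $\lambda>0$, no function in $S_{L,\lambda}$ is both real-valued and even (almost everywhere). Moreover, for every nonzero $u\in L^2(\mathbb T)$ all of whose Fourier coefficients $\hat u(n)$, $n\in\mathbb Z$, are real, the triple series defining $D_{\pi/2}(u)$ converges absolutely and $A_{\pi/2}(u)=-\|\hat u\|_{\ell^4}^4<0$. -/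

import Mathlib

open MeasureTheory AddCircle
open scoped ENNReal ComplexConjugate

noncomputable section

namespace PeriodicDMNLS

instance fact_sqrt_eight_pi_pos : Fact (0 < √(8 * Real.pi)) :=
  ⟨Real.sqrt_pos.2 (by positivity)⟩

instance fact_two_pi_pos : Fact (0 < 2 * Real.pi) := ⟨by positivity⟩

/-- The space of square-integrable complex functions of period `L`, modulo equality almost
everywhere. (Normalized Haar measure on the circle of length `L` is `1 / L` times Lebesgue
measure, so it gives the same functions; the factors `L` are kept explicit below.) -/
abbrev L2per (L : ℝ) [Fact (0 < L)] : Type := Lp ℂ 2 (haarAddCircle (T := L))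

theorem memℓp_phase {L : ℝ} [Fact (0 < L)] (t : ℝ) (u : L2per L) :
    Memℓp (fun n : ℤ => Complex.exp (-Complex.I * ((2 * Real.pi * n / L) ^ 2 * t : ℝ)) *
      fourierCoeff u n) 2 := by
  have h : Memℓp (fun n : ℤ => fourierCoeff u n) 2 := by
    have h0 := lp.memℓp (fourierBasis.repr u)
    have h1 : ((fourierBasis.repr u : lp (fun _ : ℤ => ℂ) 2) : ℤ → ℂ) =
        fun n : ℤ => fourierCoeff u n := by
      funext n
      exact fourierBasis_repr u n
    rwa [h1] at h0
  rw [memℓp_gen_iff (by norm_num)] at h ⊢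
  refine h.congr fun n => ?_
  rw [norm_mul]
  have : ‖Complex.exp (-Complex.I * ((2 * Real.pi * n / L) ^ 2 * t : ℝ))‖ = 1 := by
    rw [Complex.norm_exp]
    generalize (2 * Real.pi * n / L) ^ 2 * t = r
    simp
  rw [this, one_mul]

/-- The solution operator `T_t` of the linear Schrödinger equation `i v_t + v_xx = 0` with period
`L`: the Fourier multiplier with symbol `exp (-i (2 π n / L) ^ 2 t)`. -/
def schrodinger {L : ℝ} [Fact (0 < L)] (t : ℝ) (u : L2per L) : L2per L :=
  fourierBasis.repr.symm ⟨_, memℓp_phase t u⟩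

theorem fourierCoeff_schrodinger {L : ℝ} [Fact (0 < L)] (t : ℝ) (u : L2per L) (n : ℤ) :
    fourierCoeff (schrodinger t u) n =
      Complex.exp (-Complex.I * ((2 * Real.pi * n / L) ^ 2 * t : ℝ)) * fourierCoeff u n := by
  rw [← fourierBasis_repr, schrodinger, LinearIsometryEquiv.apply_symm_apply]

/-- The space-time integral of `|T_t u(x)| ^ 4` over one period in `x` and over `0 ≤ t ≤ 1`.
The integral in `x` is the inner one, so that the value does not depend on the representatives
of the classes `T_t u`. -/
def quarticIntegral {L : ℝ} [Fact (0 < L)] (u : L2per L) : ℝ≥0∞ :=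
  ∫⁻ t in Set.Icc (0 : ℝ) 1, ∫⁻ x : AddCircle L, ‖schrodinger t u x‖ₑ ^ 4

/-- The Hamiltonian `H_L(u) = -(2 π / L) ∫₀ᴸ ∫₀¹ |T_t u(x)| ^ 4 dt dx`. -/
def hamiltonian {L : ℝ} [Fact (0 < L)] (u : L2per L) : ℝ :=
  -(2 * Real.pi / L) * (quarticIntegral u).toReal

/-- `P(u) = (1 / 2) ∫₀ᴸ |u| ^ 2 dx`; here `dx` is Lebesgue measure, of total mass `L`. -/
def power {L : ℝ} [Fact (0 < L)] (u : L2per L) : ℝ :=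
  (1 / 2) * ∫ x : AddCircle L, ‖u x‖ ^ 2

/-- The set `S_{L,lam}` of all minimizers of `H_L` subject to the constraint `P = lam`. -/
def groundStates (L : ℝ) [Fact (0 < L)] (lam : ℝ) : Set (L2per L) :=
  {φ | power φ = lam ∧ ∀ ψ : L2per L, power ψ = lam → hamiltonian φ ≤ hamiltonian ψ}

def IsRealValued {L : ℝ} [Fact (0 < L)] (u : L2per L) : Prop :=
  ∀ᵐ x ∂(haarAddCircle (T := L)), (u x).im = 0

def IsEven {L : ℝ} [Fact (0 < L)] (u : L2per L) : Prop :=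
  ∀ᵐ x ∂(haarAddCircle (T := L)), u (-x) = u x

/-- The term with index `(l, n, p)` of the series defining `D_B(u)`; terms with `l = 0` or `p = 0`
are left out. -/
def dTerm (B : ℝ) (u : L2per (2 * Real.pi)) (i : ℤ × ℤ × ℤ) : ℂ :=
  if i.1 = 0 ∨ i.2.2 = 0 then 0
  else fourierCoeff u i.2.1 * conj (fourierCoeff u (i.2.1 - i.1)) *
    conj (fourierCoeff u (i.2.1 - i.2.2)) * fourierCoeff u (i.2.1 - i.2.2 - i.1) *
    ∫ t in (0 : ℝ)..B, Complex.exp (-2 * Complex.I * i.1 * i.2.2 * t)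

/-- `D_B(u) = 2 π ∑_{l ≠ 0} ∑_n ∑_{p ≠ 0} û(n) û(n-l)⁻ û(n-p)⁻ û(n-p-l) ∫₀ᴮ e^{-2ilpt} dt`,
where `⁻` stands for complex conjugation. -/
def dFunctional (B : ℝ) (u : L2per (2 * Real.pi)) : ℂ :=
  2 * Real.pi * ∑' i : ℤ × ℤ × ℤ, dTerm B u i

/-- The fourth power of the `ℓ⁴` norm of the sequence of Fourier coefficients of `u`. -/
def l4pow (u : L2per (2 * Real.pi)) : ℝ :=
  ∑' n : ℤ, ‖fourierCoeff u n‖ ^ 4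

/-- `A_B(u) = D_B(u) / (2 π B) - ‖û‖_{ℓ⁴} ^ 4`, as a complex number. -/
def aFunctional (B : ℝ) (u : L2per (2 * Real.pi)) : ℂ :=
  dFunctional B u / (2 * Real.pi * B) - l4pow u

end PeriodicDMNLS

end

/-! By Parseval, the spatial integral of `|T_t u|^4` is a sum over `k` of squared convolutions of
Fourier coefficients. Integrating in time gives a quartic form in the coefficients `f` with kernel
`∫₀¹ e^{-iπlpt} dt` (`quarticIntegral_eq`). For `B = π / 2` this kernel is 1 when `l = 0` or `p =
0`, and otherwise vanishes unless `l` and `p` are both odd, where it is `-2i / (π l p)`. Hence `H =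
-2π (2 m² + Re form kernel f)` with `m` the `ℓ²` mass, and minimizing `H` at fixed `P` means
maximizing `Re form kernel` at fixed mass.

The odd part of the kernel is odd in `l`. For real coefficients the quartic product is invariant
under `(l, n, p) ↦ (-l, n - l, p)`, so the odd part sums to zero and only `-‖f‖₄⁴` remains
(`form_oddKernel_eq_zero`). Real even functions have real coefficients, so their form is
nonpositive. The coefficients `1, 1, i, -i` give `16 / π - 4 > 0`, so the maximum is positive and no
real even function attains it.

A maximizer exists by concentration compactness on `ℓ²(ℤ)` (`exists_maximizer`). The form is
translation invariant; positivity excludes vanishing; splitting into masses `s` and `1 - s` is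
excluded because the form has degree 4 and `s² + (1 - s)² < 1` for `0 < s < 1`. -/

noncomputable section

namespace PeriodicDMNLS

/-! ### Fourier series on the circle and the `L⁴` norm. -/

section Circle

variable {L : ℝ} [Fact (0 < L)]

/-- Pairing with `h` is a continuous functional on `C(AddCircle L, ℂ)` that kills the monomials,
whose span is dense. -/
theorem integral_continuous_mul_eq_zero {h : AddCircle L → ℂ}
    (hh : Integrable h haarAddCircle) (hc : ∀ n, fourierCoeff h n = 0) (φ : C(AddCircle L, ℂ)) :
    ∫ x, φ x * h x ∂haarAddCircle = 0 := by
  have hint : ∀ ψ : C(AddCircle L, ℂ), Integrable (fun x => ψ x * h x) haarAddCircle := fun ψ =>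
    hh.bdd_mul (c := ‖ψ‖) ψ.continuous.aestronglyMeasurable (ae_of_all _ ψ.norm_coe_le_norm)
  let Λ : C(AddCircle L, ℂ) →ₗ[ℂ] ℂ :=
    { toFun := fun ψ => ∫ x, ψ x * h x ∂haarAddCircle
      map_add' := fun ψ χ => by
        simp only [ContinuousMap.add_apply, add_mul]
        exact integral_add (hint ψ) (hint χ)
      map_smul' := fun a ψ => by
        simp only [ContinuousMap.smul_apply, smul_eq_mul, mul_assoc, RingHom.id_apply]
        exact integral_const_mul _ _ }
  let Λc : C(AddCircle L, ℂ) →L[ℂ] ℂ := Λ.mkContinuous (∫ x, ‖h x‖ ∂haarAddCircle) fun ψ => by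
    calc ‖∫ x, ψ x * h x ∂haarAddCircle‖ ≤ ∫ x, ‖h x‖ * ‖ψ‖ ∂haarAddCircle := by
          refine norm_integral_le_of_norm_le (hh.norm.mul_const _) (ae_of_all _ fun x => ?_)
          rw [norm_mul, mul_comm]
          exact mul_le_mul_of_nonneg_left (ψ.norm_coe_le_norm x) (norm_nonneg _)
      _ = _ := integral_mul_const _ _
  have hspan : (Submodule.span ℂ (Set.range (@fourier L))) ≤ LinearMap.ker Λc.toLinearMap := by
    rw [Submodule.span_le]
    rintro _ ⟨n, rfl⟩
    have := hc (-n)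
    simpa [fourierCoeff, Λc, Λ] using this
  have htop : (⊤ : Submodule ℂ C(AddCircle L, ℂ)) ≤ LinearMap.ker Λc.toLinearMap := by
    rw [← span_fourier_closure_eq_top]
    exact Submodule.topologicalClosure_minimal _ hspan Λc.isClosed_ker
  exact htop (Submodule.mem_top (x := φ))

/-- Indicators of closed sets are bounded pointwise limits of continuous functions. Uniqueness is
needed for integrable `h`, since it is applied to the square of an `L²` function. -/
theorem ae_eq_zero_of_fourierCoeff_eq_zero {h : AddCircle L → ℂ}
    (hh : Integrable h haarAddCircle) (hc : ∀ n, fourierCoeff h n = 0) :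
    h =ᵐ[haarAddCircle] 0 := by
  refine ae_eq_zero_of_forall_setIntegral_isClosed_eq_zero hh fun s hs => ?_
  have hlim : Filter.Tendsto
      (fun j => ∫ x, (((hs.apprSeq j x : NNReal) : ℝ) : ℂ) * h x ∂haarAddCircle) Filter.atTop
      (nhds (∫ x, s.indicator h x ∂haarAddCircle)) := by
    refine tendsto_integral_of_dominated_convergence (fun x => ‖h x‖) (fun j => ?_) hh.norm
      (fun j => ae_of_all _ fun x => ?_) (ae_of_all _ fun x => ?_)
    · refine AEStronglyMeasurable.mul ?_ hh.aestronglyMeasurable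
      exact (Complex.continuous_ofReal.comp
        (NNReal.continuous_coe.comp (hs.apprSeq j).continuous)).aestronglyMeasurable
    · rw [norm_mul, Complex.norm_real, Real.norm_of_nonneg NNReal.zero_le_coe]
      refine mul_le_of_le_one_left (norm_nonneg _) ?_
      exact_mod_cast HasOuterApproxClosed.apprSeq_apply_le_one hs j x
    · have h1 := (tendsto_pi_nhds.1 (HasOuterApproxClosed.tendsto_apprSeq hs)) x
      have h2 : Filter.Tendsto (fun j => (((hs.apprSeq j x : NNReal) : ℝ) : ℂ) * h x) Filter.atTop
          (nhds ((((s.indicator (fun _ => (1 : NNReal)) x : NNReal) : ℝ) : ℂ) * h x)) :=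
        ((Complex.continuous_ofReal.comp NNReal.continuous_coe).tendsto _ |>.comp h1).mul_const _
      convert h2 using 2
      by_cases hx : x ∈ s <;> simp [hx]
  have hz : ∀ j, ∫ x, (((hs.apprSeq j x : NNReal) : ℝ) : ℂ) * h x ∂haarAddCircle = 0 := fun j =>
    integral_continuous_mul_eq_zero hh hc
      ⟨fun x => (((hs.apprSeq j x : NNReal) : ℝ) : ℂ),
        Complex.continuous_ofReal.comp (NNReal.continuous_coe.comp (hs.apprSeq j).continuous)⟩
  simp only [hz] at hlim
  rw [← integral_indicator hs.measurableSet]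
  exact (tendsto_nhds_unique hlim tendsto_const_nhds)

theorem summable_sq_fourierCoeff (u : L2per L) : Summable fun n => ‖fourierCoeff u n‖ ^ 2 :=
  (hasSum_sq_fourierCoeff u).summable

theorem exists_fourierCoeff_eq {c : ℤ → ℂ} (hc : Summable fun n => ‖c n‖ ^ 2) :
    ∃ u : L2per L, ∀ n, fourierCoeff u n = c n := by
  have hm : Memℓp c 2 := by
    rw [memℓp_gen_iff (by norm_num)]
    simpa using hc
  refine ⟨fourierBasis.repr.symm ⟨c, hm⟩, fun n => ?_⟩
  rw [← fourierBasis_repr, LinearIsometryEquiv.apply_symm_apply]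

theorem integrable_sq (f : L2per L) : Integrable (fun x => f x * f x) (haarAddCircle (T := L)) :=
  (Lp.memLp f).integrable_mul (Lp.memLp f)

/-- The Fourier coefficients of the square of an `L²` function are given by a convolution. -/
theorem fourierCoeff_sq (f : L2per L) (k : ℤ) :
    fourierCoeff (fun x => f x * f x) k = ∑' n, fourierCoeff f n * fourierCoeff f (k - n) := by
  -- The `k`-th coefficient of `f²` is the `L²` inner product of this function with `f`, so Parseval
  -- applies.
  have hg : MemLp (fun x => fourier k x * conj (f x)) 2 (haarAddCircle (T := L)) := by
    refine (Lp.memLp f).of_le ?_ (ae_of_all _ fun x => ?_)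
    · exact (fourier k).continuous.aestronglyMeasurable.mul
        (Complex.continuous_conj.comp_aestronglyMeasurable (Lp.aestronglyMeasurable f))
    · rw [norm_mul, fourier_apply, Circle.norm_coe, one_mul, RCLike.norm_conj]
  have hcoef : ∀ n, fourierCoeff (hg.toLp _) n = conj (fourierCoeff f (k - n)) := by
    intro n
    rw [fourierCoeff_congr_ae hg.coeFn_toLp, fourierCoeff, fourierCoeff, ← integral_conj]
    congr 1
    ext x
    simp only [smul_eq_mul, map_mul, ← fourier_neg, ← mul_assoc, ← fourier_add]
    congr 3
    ring
  have h := fourierBasis.tsum_inner_mul_inner (hg.toLp _) f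
  rw [MeasureTheory.L2.inner_def] at h
  have h1 : fourierCoeff (fun x => f x * f x) k =
      ∫ x, inner ℂ (hg.toLp _ x) (f x) ∂(haarAddCircle (T := L)) := by
    refine integral_congr_ae ?_
    filter_upwards [hg.coeFn_toLp] with x hx
    rw [hx, RCLike.inner_apply', map_mul, Complex.conj_conj, ← fourier_neg, smul_eq_mul, mul_assoc]
  rw [h1, ← h]
  refine tsum_congr fun n => ?_
  rw [← fourierBasis.repr_apply_apply, fourierBasis_repr, ← inner_conj_symm,
    ← fourierBasis.repr_apply_apply, fourierBasis_repr, hcoef, Complex.conj_conj, mul_comm]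

theorem lintegral_enorm_sq_eq_tsum {g : AddCircle L → ℂ} (hg : MemLp g 2 haarAddCircle) :
    ∫⁻ x, ‖g x‖ₑ ^ 2 ∂haarAddCircle = ∑' k, ‖fourierCoeff g k‖ₑ ^ 2 := by
  have h := hasSum_sq_fourierCoeff hg.toLp
  rw [fourierCoeff_congr_ae hg.coeFn_toLp] at h
  have h1 : ∫ x, ‖hg.toLp g x‖ ^ 2 ∂haarAddCircle = ∫ x, ‖g x‖ ^ 2 ∂haarAddCircle :=
    integral_congr_ae (by filter_upwards [hg.coeFn_toLp] with x hx; rw [hx])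
  rw [h1] at h
  have hint : Integrable (fun x => ‖g x‖ ^ 2) haarAddCircle := hg.integrable_norm_pow (by norm_num)
  have h2 := ofReal_integral_eq_lintegral_ofReal hint (ae_of_all _ fun x => by positivity)
  have h3 := ENNReal.ofReal_tsum_of_nonneg (fun k => by positivity) h.summable
  rw [h.tsum_eq, h2] at h3
  simpa [ENNReal.ofReal_pow] using h3

/-- The fourth power of the `L⁴` norm in terms of Fourier coefficients, finite or not. -/
theorem lintegral_enorm_pow_four (f : L2per L) :
    ∫⁻ x, ‖f x‖ₑ ^ 4 ∂haarAddCircle =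
      ∑' k, ‖∑' n, fourierCoeff f n * fourierCoeff f (k - n)‖ₑ ^ 2 := by
  have hsq : ∫⁻ x, ‖f x‖ₑ ^ 4 ∂haarAddCircle = ∫⁻ x, ‖f x * f x‖ₑ ^ 2 ∂haarAddCircle := by
    refine lintegral_congr fun x => ?_
    rw [enorm_mul]; ring
  simp_rw [← fourierCoeff_sq, hsq]
  by_cases hm : MemLp (fun x => f x * f x) 2 (haarAddCircle (T := L))
  · exact lintegral_enorm_sq_eq_tsum hm
  have hmeas : AEStronglyMeasurable (fun x => f x * f x) (haarAddCircle (T := L)) :=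
    (integrable_sq f).aestronglyMeasurable
  have hL : ∫⁻ x, ‖f x * f x‖ₑ ^ 2 ∂(haarAddCircle (T := L)) = ⊤ := by
    by_contra hne
    refine hm ⟨hmeas, ?_⟩
    rw [eLpNorm_lt_top_iff_lintegral_rpow_enorm_lt_top (by norm_num) (by norm_num)]
    simpa [lt_top_iff_ne_top] using hne
  rw [hL]
  -- If the coefficients of `f²` were square summable, they would be those of some `g` in `L²`, and
  -- uniqueness would give `f² = g` almost everywhere.
  by_contra hne
  have hs : Summable fun k => ‖fourierCoeff (fun x => f x * f x) k‖ ^ 2 := by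
    have h1 := ENNReal.summable_toReal (Ne.symm hne)
    simpa using h1
  obtain ⟨g, hg⟩ := exists_fourierCoeff_eq (L := L) hs
  have hgi : Integrable g (haarAddCircle (T := L)) := (Lp.memLp g).integrable (by norm_num)
  have hz := ae_eq_zero_of_fourierCoeff_eq_zero (L := L)
    (h := (fun x => f x * f x) + fun x => (-1 : ℂ) * g x)
    ((integrable_sq f).add (hgi.const_mul _)) (fun n => by
      rw [fourierCoeff.add (integrable_sq f) (hgi.const_mul _), Pi.add_apply,
        fourierCoeff.const_mul, hg]
      ring)
  refine hm ((memLp_congr_ae ?_).1 (Lp.memLp g))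
  filter_upwards [hz] with x hx
  simp only [Pi.add_apply, Pi.zero_apply] at hx
  linear_combination -hx

end Circle

/-! ### Quartic forms on sequences and summation over triples of indices. -/

/-- The square of the `ℓ²` norm of a sequence. -/
def mass (f : ℤ → ℂ) : ℝ := ∑' n, ‖f n‖ ^ 2

/-- The product `f(n) f(n-l)⁻ f(n-p)⁻ f(n-p-l)` at the index `(l, n, p)`. -/
def quad (f : ℤ → ℂ) (i : ℤ × ℤ × ℤ) : ℂ :=
  f i.2.1 * conj (f (i.2.1 - i.1)) * conj (f (i.2.1 - i.2.2)) * f (i.2.1 - i.2.2 - i.1)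

/-- The quartic form with kernel `w`. -/
def form (w : ℤ → ℤ → ℂ) (f : ℤ → ℂ) : ℂ := ∑' i : ℤ × ℤ × ℤ, w i.1 i.2.2 * quad f i

section Sums

theorem hasSum_of_eq {ι : Type*} {f g : ι → ℝ} {a b : ℝ} (h : HasSum f a) (hfg : ∀ i, g i = f i)
    (hab : a = b) : HasSum g b :=
  hab ▸ (funext hfg : g = f) ▸ h

theorem hasSum_triple {a b c : ℤ → ℝ} (ha : Summable a) (hb : Summable b) (hc : Summable c)
    (ha0 : ∀ n, 0 ≤ a n) (hb0 : ∀ n, 0 ≤ b n) (hc0 : ∀ n, 0 ≤ c n) :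
    HasSum (fun i : ℤ × ℤ × ℤ => a i.1 * (b i.2.1 * c i.2.2))
      ((∑' n, a n) * ((∑' n, b n) * ∑' n, c n)) := by
  have hbc := hb.mul_of_nonneg hc hb0 hc0
  have habc := ha.mul_of_nonneg hbc ha0 (fun i => mul_nonneg (hb0 _) (hc0 _))
  exact ha.hasSum.mul (hb.hasSum.mul hc.hasSum hbc) habc

/-- `(l, n, p) ↦ (l, n, n - p - l)` -/
def outerLeft : ℤ × ℤ × ℤ ≃ ℤ × ℤ × ℤ where
  toFun i := (i.1, i.2.1, i.2.1 - i.2.2 - i.1)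
  invFun i := (i.1, i.2.1, i.2.1 - i.2.2 - i.1)
  left_inv i := by ext <;> simp; ring
  right_inv i := by ext <;> simp; ring

/-- `(l, n, p) ↦ (p, n, n - p - l)` -/
def outerRight : ℤ × ℤ × ℤ ≃ ℤ × ℤ × ℤ where
  toFun i := (i.2.2, i.2.1, i.2.1 - i.2.2 - i.1)
  invFun i := (i.2.1 - i.2.2 - i.1, i.2.1, i.1)
  left_inv i := by ext <;> simp; ring
  right_inv i := by ext <;> simp

/-- `(l, n, p) ↦ (l, n - l, n - p)` -/
def innerLeft : ℤ × ℤ × ℤ ≃ ℤ × ℤ × ℤ where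
  toFun i := (i.1, i.2.1 - i.1, i.2.1 - i.2.2)
  invFun i := (i.1, i.2.1 + i.1, i.2.1 + i.1 - i.2.2)
  left_inv i := by ext <;> simp
  right_inv i := by ext <;> simp

/-- `(l, n, p) ↦ (p, n - l, n - p)` -/
def innerRight : ℤ × ℤ × ℤ ≃ ℤ × ℤ × ℤ where
  toFun i := (i.2.2, i.2.1 - i.1, i.2.1 - i.2.2)
  invFun i := (i.2.2 + i.1 - i.2.1, i.2.2 + i.1, i.1)
  left_inv i := by ext <;> simp
  right_inv i := by ext <;> simp

variable {V a b : ℤ → ℝ}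

/-- For either of `l` and `p`, that index together with `n` and `n - p - l` gives free coordinates
on `ℤ³`, so each half of the sum factors. -/
theorem hasSum_outer (hV : Summable V) (ha : Summable a) (hb : Summable b)
    (hV0 : ∀ n, 0 ≤ V n) (ha0 : ∀ n, 0 ≤ a n) (hb0 : ∀ n, 0 ≤ b n) :
    HasSum (fun i : ℤ × ℤ × ℤ => (V i.1 + V i.2.2) * (a i.2.1 * b (i.2.1 - i.2.2 - i.1)))
      (2 * (∑' n, V n) * ((∑' n, a n) * ∑' n, b n)) := by
  have h := hasSum_triple hV ha hb hV0 ha0 hb0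
  have h1 := (outerLeft.hasSum_iff.2 h).add (outerRight.hasSum_iff.2 h)
  convert h1 using 1
  · funext i
    simp only [Function.comp, outerLeft, outerRight, Equiv.coe_fn_mk]
    ring
  · ring

theorem hasSum_inner (hV : Summable V) (ha : Summable a) (hb : Summable b)
    (hV0 : ∀ n, 0 ≤ V n) (ha0 : ∀ n, 0 ≤ a n) (hb0 : ∀ n, 0 ≤ b n) :
    HasSum (fun i : ℤ × ℤ × ℤ => (V i.1 + V i.2.2) * (a (i.2.1 - i.1) * b (i.2.1 - i.2.2)))
      (2 * (∑' n, V n) * ((∑' n, a n) * ∑' n, b n)) := by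
  have h := hasSum_triple hV ha hb hV0 ha0 hb0
  have h1 := (innerLeft.hasSum_iff.2 h).add (innerRight.hasSum_iff.2 h)
  convert h1 using 1
  · funext i
    simp only [Function.comp, innerLeft, innerRight, Equiv.coe_fn_mk]
    ring
  · ring

end Sums

/-! ### Bounds, continuity, truncation and splitting of quartic forms. -/

section Form

variable {V : ℤ → ℝ} {w w₁ w₂ : ℤ → ℤ → ℂ} {f g : ℤ → ℂ}

theorem mass_nonneg (f : ℤ → ℂ) : 0 ≤ mass f := tsum_nonneg fun _ => by positivity

theorem sum_le_mass (hf : Summable fun n => ‖f n‖ ^ 2) (s : Finset ℤ) :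
    ∑ n ∈ s, ‖f n‖ ^ 2 ≤ mass f := hf.sum_le_tsum s fun _ _ => by positivity

theorem sq_le_mass (hf : Summable fun n => ‖f n‖ ^ 2) (n : ℤ) : ‖f n‖ ^ 2 ≤ mass f :=
  hf.le_tsum n fun _ _ => by positivity

/-- AM-GM with the pairing outer times outer, inner times inner: these are the pairs that
`hasSum_outer` and `hasSum_inner` can sum against `V l + V p`. -/
theorem norm_quad_le (f : ℤ → ℂ) (i : ℤ × ℤ × ℤ) :
    ‖quad f i‖ ≤ (1 / 2) * (‖f i.2.1‖ ^ 2 * ‖f (i.2.1 - i.2.2 - i.1)‖ ^ 2) +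
      (1 / 2) * (‖f (i.2.1 - i.1)‖ ^ 2 * ‖f (i.2.1 - i.2.2)‖ ^ 2) := by
  simp only [quad, norm_mul, RCLike.norm_conj]
  nlinarith [sq_nonneg (‖f i.2.1‖ * ‖f (i.2.1 - i.2.2 - i.1)‖ -
    ‖f (i.2.1 - i.1)‖ * ‖f (i.2.1 - i.2.2)‖)]

theorem hasSum_majorant (hV : Summable V) (hV0 : ∀ n, 0 ≤ V n)
    (hf : Summable fun n => ‖f n‖ ^ 2) :
    HasSum (fun i : ℤ × ℤ × ℤ => (V i.1 + V i.2.2) *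
      ((1 / 2) * (‖f i.2.1‖ ^ 2 * ‖f (i.2.1 - i.2.2 - i.1)‖ ^ 2) +
      (1 / 2) * (‖f (i.2.1 - i.1)‖ ^ 2 * ‖f (i.2.1 - i.2.2)‖ ^ 2)))
      (2 * (∑' n, V n) * mass f ^ 2) := by
  have h0 : ∀ n, 0 ≤ ‖f n‖ ^ 2 := fun n => by positivity
  refine hasSum_of_eq (((hasSum_outer hV hf hf hV0 h0 h0).mul_left (1 / 2)).add
    ((hasSum_inner hV hf hf hV0 h0 h0).mul_left (1 / 2))) (fun i => by ring) ?_
  rw [← mass.eq_def]; ring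

theorem norm_form_term_le (hw : ∀ l p, ‖w l p‖ ≤ V l + V p) (f : ℤ → ℂ) (i : ℤ × ℤ × ℤ) :
    ‖w i.1 i.2.2 * quad f i‖ ≤ (V i.1 + V i.2.2) *
      ((1 / 2) * (‖f i.2.1‖ ^ 2 * ‖f (i.2.1 - i.2.2 - i.1)‖ ^ 2) +
      (1 / 2) * (‖f (i.2.1 - i.1)‖ ^ 2 * ‖f (i.2.1 - i.2.2)‖ ^ 2)) := by
  rw [norm_mul]
  exact mul_le_mul (hw _ _) (norm_quad_le f i) (norm_nonneg _) ((norm_nonneg _).trans (hw _ _))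

theorem summable_form (hV : Summable V) (hV0 : ∀ n, 0 ≤ V n) (hw : ∀ l p, ‖w l p‖ ≤ V l + V p)
    (hf : Summable fun n => ‖f n‖ ^ 2) :
    Summable fun i : ℤ × ℤ × ℤ => w i.1 i.2.2 * quad f i :=
  (hasSum_majorant hV hV0 hf).summable.of_norm_bounded (norm_form_term_le hw f)

theorem norm_form_le (hV : Summable V) (hV0 : ∀ n, 0 ≤ V n) (hw : ∀ l p, ‖w l p‖ ≤ V l + V p)
    (hf : Summable fun n => ‖f n‖ ^ 2) : ‖form w f‖ ≤ 2 * (∑' n, V n) * mass f ^ 2 :=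
  tsum_of_norm_bounded (hasSum_majorant hV hV0 hf) (norm_form_term_le hw f)

theorem norm_form_le_mul (hV : Summable V) (hV0 : ∀ n, 0 ≤ V n) {ε : ℝ} (hε : 0 ≤ ε)
    (hw : ∀ l p, ‖w l p‖ ≤ ε * (V l + V p)) (hf : Summable fun n => ‖f n‖ ^ 2) :
    ‖form w f‖ ≤ 2 * ε * (∑' n, V n) * mass f ^ 2 := by
  have h := norm_form_le (V := fun n => ε * V n) (hV.mul_left ε) (fun n => mul_nonneg hε (hV0 n))
    (w := w) (fun l p => (hw l p).trans_eq (by ring)) hf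
  rw [tsum_mul_left] at h
  exact h.trans_eq (by ring)

theorem form_smul (w : ℤ → ℤ → ℂ) (r : ℝ) (f : ℤ → ℂ) :
    form w (fun n => r * f n) = r ^ 4 * form w f := by
  rw [form, form, ← tsum_mul_left]
  refine tsum_congr fun i => ?_
  simp only [quad, map_mul, Complex.conj_ofReal]
  ring

theorem mass_smul (r : ℝ) (f : ℤ → ℂ) : mass (fun n => r * f n) = r ^ 2 * mass f := by
  rw [mass, mass, ← tsum_mul_left]
  refine tsum_congr fun n => ?_
  rw [norm_mul, mul_pow, Complex.norm_real, Real.norm_eq_abs, sq_abs]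

/-- The kernel sees only differences of indices. This is the noncompact symmetry that recentring
must remove. -/
theorem form_shift (w : ℤ → ℤ → ℂ) (k : ℤ) (f : ℤ → ℂ) :
    form w (fun n => f (n + k)) = form w f := by
  let e : ℤ × ℤ × ℤ ≃ ℤ × ℤ × ℤ :=
    (Equiv.refl ℤ).prodCongr ((Equiv.addRight k).prodCongr (Equiv.refl ℤ))
  rw [form, form, ← e.tsum_eq (fun i => w i.1 i.2.2 * quad f i)]
  refine tsum_congr fun i => ?_
  simp only [quad, e, Equiv.prodCongr_apply, Prod.map, Equiv.refl_apply, Equiv.coe_addRight]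
  rw [show i.2.1 + k - i.1 = i.2.1 - i.1 + k by ring,
    show i.2.1 + k - i.2.2 = i.2.1 - i.2.2 + k by ring,
    show i.2.1 - i.2.2 + k - i.1 = i.2.1 - i.2.2 - i.1 + k by ring]

theorem mass_shift (k : ℤ) (f : ℤ → ℂ) : mass (fun n => f (n + k)) = mass f :=
  (Equiv.addRight k).tsum_eq fun n => ‖f n‖ ^ 2

/-- Weighted AM-GM leaves only squares, which can be summed exactly, and so replaces a
Cauchy-Schwarz inequality over triples. -/
theorem norm_mul_sub_mul_le {P P' Q Q' : ℂ} {τ : ℝ} (hτ : 0 < τ) :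
    ‖P * Q - P' * Q'‖ ≤ (1 / 2) * ((‖P - P'‖ ^ 2 + ‖Q - Q'‖ ^ 2) / τ + τ * (‖Q‖ ^ 2 + ‖P'‖ ^ 2)) := by
  have amgm : ∀ x y : ℝ, x * y ≤ (1 / 2) * (x ^ 2 / τ + τ * y ^ 2) := fun x y => by
    have h : 0 ≤ (x - τ * y) ^ 2 / τ := by positivity
    have h2 : (x - τ * y) ^ 2 / τ = x ^ 2 / τ - 2 * (x * y) + τ * y ^ 2 := by field_simp; ring
    linarith
  have h1 : P * Q - P' * Q' = (P - P') * Q + (Q - Q') * P' := by ring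
  calc ‖P * Q - P' * Q'‖ ≤ ‖P - P'‖ * ‖Q‖ + ‖Q - Q'‖ * ‖P'‖ := by
        rw [h1, ← norm_mul, ← norm_mul]; exact norm_add_le _ _
    _ ≤ (1 / 2) * (‖P - P'‖ ^ 2 / τ + τ * ‖Q‖ ^ 2) + (1 / 2) * (‖Q - Q'‖ ^ 2 / τ + τ * ‖P'‖ ^ 2) :=
        add_le_add (amgm _ _) (amgm _ _)
    _ = _ := by ring

theorem norm_mul_sub_mul_sq_le (a b a' b' : ℂ) :
    ‖a * b - a' * b'‖ ^ 2 ≤ 2 * (‖a - a'‖ ^ 2 * ‖b‖ ^ 2) + 2 * (‖a'‖ ^ 2 * ‖b - b'‖ ^ 2) := by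
  have h1 : a * b - a' * b' = (a - a') * b + a' * (b - b') := by ring
  have h2 : ‖a * b - a' * b'‖ ≤ ‖a - a'‖ * ‖b‖ + ‖a'‖ * ‖b - b'‖ := by
    rw [h1, ← norm_mul, ← norm_mul]; exact norm_add_le _ _
  calc ‖a * b - a' * b'‖ ^ 2 ≤ (‖a - a'‖ * ‖b‖ + ‖a'‖ * ‖b - b'‖) ^ 2 :=
        pow_le_pow_left₀ (norm_nonneg _) h2 2
    _ ≤ _ := by nlinarith [sq_nonneg (‖a - a'‖ * ‖b‖ - ‖a'‖ * ‖b - b'‖)]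

theorem summable_sub (hf : Summable fun n => ‖f n‖ ^ 2) (hg : Summable fun n => ‖g n‖ ^ 2) :
    Summable fun n => ‖f n - g n‖ ^ 2 := by
  refine ((hf.add hg).mul_left 2).of_nonneg_of_le (fun n => by positivity) fun n => ?_
  nlinarith [norm_sub_le (f n) (g n), norm_nonneg (f n - g n), norm_nonneg (f n),
    norm_nonneg (g n), sq_nonneg (‖f n‖ - ‖g n‖)]

/-- The quartic form is locally Lipschitz on `ℓ²`. -/
theorem norm_form_sub_le (hV : Summable V) (hV0 : ∀ n, 0 ≤ V n)
    (hw : ∀ l p, ‖w l p‖ ≤ V l + V p)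
    (hf : Summable fun n => ‖f n‖ ^ 2) (hg : Summable fun n => ‖g n‖ ^ 2)
    (hf1 : mass f ≤ 1) (hg1 : mass g ≤ 1) {τ : ℝ} (hτ : 0 < τ) :
    ‖form w f - form w g‖ ≤
      2 * (∑' n, V n) * (4 * mass (fun n => f n - g n) / τ + τ) := by
  have he := summable_sub hf hg
  have hf0 : ∀ n, 0 ≤ ‖f n‖ ^ 2 := fun n => by positivity
  have hg0 : ∀ n, 0 ≤ ‖g n‖ ^ 2 := fun n => by positivity
  have he0 : ∀ n, 0 ≤ ‖f n - g n‖ ^ 2 := fun n => by positivity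
  rw [form, form, ← (summable_form hV hV0 hw hf).tsum_sub (summable_form hV hV0 hw hg)]
  -- The `1 / τ` group bounds the differences of the outer and of the inner products; the `τ / 2`
  -- group bounds the products themselves.
  have hsum := ((((hasSum_outer hV he hf hV0 he0 hf0).add (hasSum_outer hV hg he hV0 hg0 he0)).add
    ((hasSum_inner hV he hf hV0 he0 hf0).add (hasSum_inner hV hg he hV0 hg0 he0))).mul_left
    (1 / τ)).add (((hasSum_inner hV hf hf hV0 hf0 hf0).add
      (hasSum_outer hV hg hg hV0 hg0 hg0)).mul_left (τ / 2))
  refine (tsum_of_norm_bounded hsum fun i => ?_).trans ?_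
  · rw [← mul_sub, norm_mul]
    have h1 := by
      have := norm_mul_sub_mul_le (P := f i.2.1 * f (i.2.1 - i.2.2 - i.1))
        (P' := g i.2.1 * g (i.2.1 - i.2.2 - i.1))
        (Q := conj (f (i.2.1 - i.1)) * conj (f (i.2.1 - i.2.2)))
        (Q' := conj (g (i.2.1 - i.1)) * conj (g (i.2.1 - i.2.2))) hτ
      have hq : ∀ a b c e : ℂ, a * e * (b * c) = a * b * c * e := fun a b c e => by ring
      rw [hq, hq] at this
      exact this
    have h2 := norm_mul_sub_mul_sq_le (f i.2.1) (f (i.2.1 - i.2.2 - i.1)) (g i.2.1)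
      (g (i.2.1 - i.2.2 - i.1))
    have h3 := norm_mul_sub_mul_sq_le (conj (f (i.2.1 - i.1))) (conj (f (i.2.1 - i.2.2)))
      (conj (g (i.2.1 - i.1))) (conj (g (i.2.1 - i.2.2)))
    simp only [← map_sub, RCLike.norm_conj] at h3
    rw [norm_mul (conj _), norm_mul (g _), RCLike.norm_conj, RCLike.norm_conj] at h1
    have h4 := div_le_div_of_nonneg_right (add_le_add h2 h3) hτ.le
    refine (mul_le_mul (hw _ _) (h1.trans (mul_le_mul_of_nonneg_left
      (add_le_add_left h4 _) (by norm_num))) (norm_nonneg _)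
      ((norm_nonneg _).trans (hw _ _))).trans_eq ?_
    field_simp
  · have hVs : 0 ≤ ∑' n, V n := tsum_nonneg hV0
    simp only [← mass.eq_def]
    have hE := mass_nonneg fun n => f n - g n
    have hF := mass_nonneg f
    have hG := mass_nonneg g
    set E := mass fun n => f n - g n
    set S := ∑' n, V n
    have : 1 / τ * (2 * S * (E * mass f) + 2 * S * (mass g * E) +
        (2 * S * (E * mass f) + 2 * S * (mass g * E))) +
        τ / 2 * (2 * S * (mass f * mass f) + 2 * S * (mass g * mass g)) =
        2 * S * (E / τ * (2 * (mass f + mass g)) + τ * ((mass f * mass f + mass g * mass g) / 2)) := by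
      field_simp
      ring
    rw [this]
    refine mul_le_mul_of_nonneg_left ?_ (by positivity)
    have hEτ : 0 ≤ E / τ := by positivity
    have h4 : 4 * E / τ = E / τ * 4 := by ring
    rw [h4]
    refine add_le_add (mul_le_mul_of_nonneg_left (by linarith) hEτ) ?_
    nlinarith [mul_le_one₀ hf1 hF hf1, mul_le_one₀ hg1 hG hg1]

/-- The restriction of a kernel to indices with `|l| < d` and `|p| < d`. -/
def truncate (d : ℤ) (w : ℤ → ℤ → ℂ) (l p : ℤ) : ℂ := if |l| < d ∧ |p| < d then w l p else 0

theorem norm_truncate_le (d : ℤ) (hw : ∀ l p, ‖w l p‖ ≤ V l + V p) (l p : ℤ) :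
    ‖truncate d w l p‖ ≤ V l + V p := by
  unfold truncate
  split_ifs
  · exact hw l p
  · rw [norm_zero]; exact (norm_nonneg _).trans (hw l p)

/-- The difference is the form of the discarded part of the kernel, which is dominated by `ε * (V l
+ V p)`. -/
theorem norm_form_sub_truncate_le (hV : Summable V) (hV0 : ∀ n, 0 ≤ V n)
    (hw : ∀ l p, ‖w l p‖ ≤ V l + V p) {d : ℤ} {ε : ℝ} (hε : 0 ≤ ε)
    (hd : ∀ l p, (d ≤ |l| ∨ d ≤ |p|) → ‖w l p‖ ≤ ε * (V l + V p))
    (hf : Summable fun n => ‖f n‖ ^ 2) :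
    ‖form w f - form (truncate d w) f‖ ≤ 2 * ε * (∑' n, V n) * mass f ^ 2 := by
  have h : form w f - form (truncate d w) f = form (fun l p => w l p - truncate d w l p) f := by
    rw [form, form, form, ← (summable_form hV hV0 hw hf).tsum_sub
      (summable_form hV hV0 (norm_truncate_le d hw) hf)]
    exact tsum_congr fun i => by ring
  rw [h]
  refine norm_form_le_mul hV hV0 hε (fun l p => ?_) hf
  unfold truncate
  split_ifs with hlp
  · rw [sub_self, norm_zero]
    exact mul_nonneg hε ((norm_nonneg _).trans (hw l p))
  · rw [sub_zero]
    refine hd l p ?_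
    by_contra hcon
    push Not at hcon
    exact hlp hcon

/-- A truncated quartic form is small on sequences that are uniformly small. -/
theorem norm_form_truncate_le (d : ℤ) {C δ : ℝ} (hC : ∀ l p, ‖w l p‖ ≤ C)
    (hf : Summable fun n => ‖f n‖ ^ 2) (hδ : ∀ n, ‖f n‖ ≤ δ) :
    ‖form (truncate d w) f‖ ≤
      C * δ ^ 2 * (((Finset.Ioo (-d) d).card : ℝ) ^ 2 * mass f) := by
  let χ : ℤ → ℝ := fun n => if n ∈ Finset.Ioo (-d) d then 1 else 0
  have hχ : HasSum χ ((Finset.Ioo (-d) d).card : ℝ) := by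
    have h : HasSum χ (∑ n ∈ Finset.Ioo (-d) d, χ n) :=
      hasSum_sum_of_ne_finset_zero fun b hb => if_neg hb
    rwa [Finset.sum_congr rfl fun n hn => (if_pos hn : χ n = 1), Finset.sum_const, nsmul_eq_mul,
      mul_one] at h
  have hχ0 : ∀ n, 0 ≤ χ n := fun n => by simp only [χ]; split_ifs <;> norm_num
  have hf0 : ∀ n, 0 ≤ ‖f n‖ ^ 2 := fun n => by positivity
  have hδ0 : 0 ≤ δ := (norm_nonneg _).trans (hδ 0)
  have h := hasSum_triple hχ.summable hf hχ.summable hχ0 hf0 hχ0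
  -- Two of the four factors are bounded by `δ`; the other two, at `n` and `n - l`, are split by
  -- AM-GM, and `e` makes `n - l` a free index.
  let e : ℤ × ℤ × ℤ ≃ ℤ × ℤ × ℤ :=
    { toFun := fun i => (i.1, i.2.1 - i.1, i.2.2)
      invFun := fun i => (i.1, i.2.1 + i.1, i.2.2)
      left_inv := fun i => by ext <;> simp
      right_inv := fun i => by ext <;> simp }
  have hsum := (h.add (e.hasSum_iff.2 h)).mul_left (C * δ ^ 2 / 2)
  refine (tsum_of_norm_bounded hsum fun i => ?_).trans_eq ?_
  · simp only [Function.comp, e, Equiv.coe_fn_mk, truncate]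
    split_ifs with hi
    · have h1 : χ i.1 = 1 := by simp [χ, abs_lt.1 hi.1]
      have h2 : χ i.2.2 = 1 := by simp [χ, abs_lt.1 hi.2]
      rw [h1, h2, norm_mul]
      have h3 : ‖quad f i‖ ≤ δ ^ 2 / 2 * (‖f i.2.1‖ ^ 2 + ‖f (i.2.1 - i.1)‖ ^ 2) := by
        simp only [quad, norm_mul, RCLike.norm_conj]
        have hb : ‖f (i.2.1 - i.2.2)‖ * ‖f (i.2.1 - i.2.2 - i.1)‖ ≤ δ ^ 2 := by
          rw [sq]; exact mul_le_mul (hδ _) (hδ _) (norm_nonneg _) hδ0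
        have ha : ‖f i.2.1‖ * ‖f (i.2.1 - i.1)‖ ≤
            (1 / 2) * (‖f i.2.1‖ ^ 2 + ‖f (i.2.1 - i.1)‖ ^ 2) := by
          nlinarith [sq_nonneg (‖f i.2.1‖ - ‖f (i.2.1 - i.1)‖)]
        calc _ = (‖f i.2.1‖ * ‖f (i.2.1 - i.1)‖) *
              (‖f (i.2.1 - i.2.2)‖ * ‖f (i.2.1 - i.2.2 - i.1)‖) := by ring
          _ ≤ (1 / 2) * (‖f i.2.1‖ ^ 2 + ‖f (i.2.1 - i.1)‖ ^ 2) * δ ^ 2 :=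
              mul_le_mul ha hb (by positivity) (by positivity)
          _ = _ := by ring
      refine (mul_le_mul (hC _ _) h3 (norm_nonneg _) ((norm_nonneg _).trans (hC 0 0))).trans_eq ?_
      ring
    · rw [zero_mul, norm_zero]
      have hC0 : 0 ≤ C := (norm_nonneg _).trans (hC 0 0)
      have := mul_nonneg (hχ0 i.1) (mul_nonneg (hf0 i.2.1) (hχ0 i.2.2))
      have := mul_nonneg (hχ0 i.1) (mul_nonneg (hf0 (i.2.1 - i.1)) (hχ0 i.2.2))
      positivity
  · rw [hχ.tsum_eq, ← mass.eq_def]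
    ring

/-- The restriction of a sequence to a set of indices. -/
def restrict (s : Finset ℤ) (f : ℤ → ℂ) (n : ℤ) : ℂ := if n ∈ s then f n else 0

/-- The restriction of a sequence to the complement of a set of indices. -/
def restrictCompl (s : Finset ℤ) (f : ℤ → ℂ) (n : ℤ) : ℂ := if n ∈ s then 0 else f n

theorem hasSum_restrict (s : Finset ℤ) (f : ℤ → ℂ) :
    HasSum (fun n => ‖restrict s f n‖ ^ 2) (∑ n ∈ s, ‖f n‖ ^ 2) := by
  have h : HasSum (fun n => ‖restrict s f n‖ ^ 2) (∑ n ∈ s, ‖restrict s f n‖ ^ 2) :=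
    hasSum_sum_of_ne_finset_zero fun b hb => by simp [restrict, hb]
  rwa [Finset.sum_congr rfl fun n hn => by rw [restrict, if_pos hn]] at h

theorem mass_restrict (s : Finset ℤ) (f : ℤ → ℂ) : mass (restrict s f) = ∑ n ∈ s, ‖f n‖ ^ 2 :=
  (hasSum_restrict s f).tsum_eq

theorem hasSum_restrictCompl (s : Finset ℤ) (hf : Summable fun n => ‖f n‖ ^ 2) :
    HasSum (fun n => ‖restrictCompl s f n‖ ^ 2) (mass f - ∑ n ∈ s, ‖f n‖ ^ 2) := by
  refine hasSum_of_eq (hf.hasSum.sub (hasSum_restrict s f)) (fun n => ?_) rfl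
  by_cases hn : n ∈ s <;> simp [restrict, restrictCompl, hn]

theorem mass_restrictCompl (s : Finset ℤ) (hf : Summable fun n => ‖f n‖ ^ 2) :
    mass (restrictCompl s f) = mass f - ∑ n ∈ s, ‖f n‖ ^ 2 :=
  (hasSum_restrictCompl s hf).tsum_eq

/-- A truncated quartic form splits on sequences with separated supports. -/
theorem form_truncate_separated (hV : Summable V) (hV0 : ∀ n, 0 ≤ V n)
    (hw : ∀ l p, ‖w l p‖ ≤ V l + V p) (d N : ℤ) (hf : Summable fun n => ‖f n‖ ^ 2)
    (hgap : ∀ n, N ≤ |n| → |n| < N + 2 * d → f n = 0) :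
    form (truncate d w) f = form (truncate d w) (restrict (Finset.Ioo (-N) N) f) +
      form (truncate d w) (restrictCompl (Finset.Ioo (-N) N) f) := by
  have hw' := norm_truncate_le d hw
  rw [form, form, form, ← (summable_form hV hV0 hw' (hasSum_restrict _ f).summable).tsum_add
    (summable_form hV hV0 hw' (hasSum_restrictCompl _ hf).summable)]
  refine tsum_congr fun i => ?_
  obtain ⟨l, n, p⟩ := i
  simp only [truncate]
  split_ifs with hlp
  swap
  · simp
  rw [← mul_add]
  congr 1
  obtain ⟨hl, hp⟩ := hlp
  rw [abs_lt] at hl hp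
  by_cases hz : quad f (l, n, p) = 0
  · have h4 : f n = 0 ∨ f (n - l) = 0 ∨ f (n - p) = 0 ∨ f (n - p - l) = 0 := by
      simpa [quad, or_assoc] using hz
    rw [hz]
    have hr : ∀ m, f m = 0 → restrict (Finset.Ioo (-N) N) f m = 0 ∧
        restrictCompl (Finset.Ioo (-N) N) f m = 0 := fun m hm => by
      simp [restrict, restrictCompl, hm]
    rcases h4 with h | h | h | h <;> simp [quad, (hr _ h).1, (hr _ h).2]
  · have h4 : f n ≠ 0 ∧ f (n - l) ≠ 0 ∧ f (n - p) ≠ 0 ∧ f (n - p - l) ≠ 0 := by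
      simpa [quad, and_assoc] using hz
    have key : ∀ m, f m ≠ 0 → |m| < N ∨ N + 2 * d ≤ |m| := fun m hm => by
      by_contra hcon
      push Not at hcon
      exact hm (hgap m hcon.1 hcon.2)
    have h1 := key _ h4.1
    have h2 := key _ h4.2.1
    have h3 := key _ h4.2.2.1
    have h5 := key _ h4.2.2.2
    -- With `|l|, |p| < d`, all four indices lie at distance less than `2 * d` from `n`, so none can
    -- be across the gap from it.
    have near : ∀ a b : ℤ, |a| < N → |a - b| < 2 * d → (|b| < N ∨ N + 2 * d ≤ |b|) → |b| < N := by
      intro a b ha hab hb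
      rcases hb with hb | hb
      · exact hb
      · have := abs_sub_abs_le_abs_sub b a
        rw [abs_sub_comm] at this
        omega
    have a1 : |n - (n - l)| < 2 * d := by rw [abs_lt]; constructor <;> linarith
    have a2 : |n - (n - p)| < 2 * d := by rw [abs_lt]; constructor <;> linarith
    have a3 : |n - (n - p - l)| < 2 * d := by rw [abs_lt]; constructor <;> linarith
    have mem : ∀ m, m ∈ Finset.Ioo (-N) N ↔ |m| < N := fun m => by
      rw [Finset.mem_Ioo, abs_lt]
    by_cases hn : |n| < N
    · simp [quad, restrict, restrictCompl, -Finset.mem_Ioo, mem, hn, near _ _ hn a1 h2,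
        near _ _ hn a2 h3, near _ _ hn a3 h5]
    · have far : ∀ b, |n - b| < 2 * d → (|b| < N ∨ N + 2 * d ≤ |b|) → ¬ |b| < N := by
        intro b hab _ hb
        exact hn (near b n hb (by rwa [abs_sub_comm]) h1)
      simp [quad, restrict, restrictCompl, -Finset.mem_Ioo, mem, hn, far _ a1 h2,
        far _ a2 h3, far _ a3 h5]

end Form

/-! ### Existence of a maximizer by concentration compactness. -/

open Filter Topology

section Maximizer

variable {V : ℤ → ℝ} {w : ℤ → ℤ → ℂ} {f c : ℤ → ℂ} {F : ℕ → ℤ → ℂ} {M : ℝ}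

/-- Off `s`, use `|x - y|² ≤ 2 |x|² + 2 |y|²`; the tails are then controlled by total mass minus
mass on `s`. -/
theorem mass_sub_le (s : Finset ℤ) (hf : Summable fun n => ‖f n‖ ^ 2)
    (hc : Summable fun n => ‖c n‖ ^ 2) :
    mass (fun n => f n - c n) ≤ ∑ n ∈ s, ‖f n - c n‖ ^ 2 +
      2 * (mass f - ∑ n ∈ s, ‖f n‖ ^ 2) + 2 * (mass c - ∑ n ∈ s, ‖c n‖ ^ 2) := by
  have h := ((hasSum_restrict s fun n => f n - c n).add
    ((hasSum_restrictCompl s hf).mul_left 2)).add ((hasSum_restrictCompl s hc).mul_left 2)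
  refine hasSum_le (fun n => ?_) (summable_sub hf hc).hasSum h
  by_cases hn : n ∈ s
  · simp [restrict, restrictCompl, hn]
  · simp only [restrict, restrictCompl, hn, if_false, norm_zero]
    nlinarith [norm_sub_le (f n) (c n), norm_nonneg (f n - c n), norm_nonneg (f n),
      norm_nonneg (c n), sq_nonneg (‖f n‖ - ‖c n‖)]

theorem exists_Ioo_mass_lt (hc : Summable fun n => ‖c n‖ ^ 2) {ε : ℝ} (hε : 0 < ε) :
    ∃ N : ℤ, mass c - ε < ∑ n ∈ Finset.Ioo (-N) N, ‖c n‖ ^ 2 := by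
  have h := hc.hasSum.eventually (lt_mem_nhds (sub_lt_self (mass c) hε))
  obtain ⟨s, hs⟩ := h.exists
  obtain ⟨N, hN⟩ : ∃ N : ℤ, ∀ n ∈ s, |n| < N := by
    refine ⟨∑ n ∈ s, |n| + 1, fun n hn => ?_⟩
    have := Finset.single_le_sum (f := fun n : ℤ => |n|) (fun i _ => abs_nonneg i) hn
    exact Int.lt_add_one_of_le this
  refine ⟨N, hs.trans_le (Finset.sum_le_sum_of_subset_of_nonneg (fun n hn => ?_)
    fun _ _ _ => by positivity)⟩
  rw [Finset.mem_Ioo, ← abs_lt]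
  exact hN n hn

theorem tendsto_sum_sq (hlim : ∀ n, Tendsto (fun j => F j n) atTop (𝓝 (c n))) (s : Finset ℤ) :
    Tendsto (fun j => ∑ n ∈ s, ‖F j n‖ ^ 2) atTop (𝓝 (∑ n ∈ s, ‖c n‖ ^ 2)) :=
  tendsto_finsetSum _ fun n _ => ((hlim n).norm).pow 2

theorem summable_of_tendsto (hF : ∀ j, Summable fun n => ‖F j n‖ ^ 2) (hF1 : ∀ j, mass (F j) = 1)
    (hlim : ∀ n, Tendsto (fun j => F j n) atTop (𝓝 (c n))) :
    (Summable fun n => ‖c n‖ ^ 2) ∧ mass c ≤ 1 := by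
  have hs : ∀ s : Finset ℤ, ∑ n ∈ s, ‖c n‖ ^ 2 ≤ 1 := fun s =>
    le_of_tendsto (tendsto_sum_sq hlim s)
      (Eventually.of_forall fun j => (sum_le_mass (hF j) s).trans_eq (hF1 j))
  have hsum := summable_of_sum_le (fun n => by positivity) hs
  exact ⟨hsum, hsum.tsum_le_of_sum_le hs⟩

/-- A sequence of unit vectors converging pointwise to `c` splits, for the quartic form, into
a part of mass almost `mass c` and a far part. -/
theorem le_of_pointwise_limit (hV : Summable V) (hV0 : ∀ n, 0 ≤ V n)
    (hw : ∀ l p, ‖w l p‖ ≤ V l + V p) (hM0 : 0 ≤ M)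
    (hM : ∀ f : ℤ → ℂ, (Summable fun n => ‖f n‖ ^ 2) → (form w f).re ≤ M * mass f ^ 2)
    (hF : ∀ j, Summable fun n => ‖F j n‖ ^ 2) (hF1 : ∀ j, mass (F j) = 1)
    (hFM : Tendsto (fun j => (form w (F j)).re) atTop (𝓝 M))
    (hlim : ∀ n, Tendsto (fun j => F j n) atTop (𝓝 (c n)))
    {d : ℤ} {ε : ℝ} (hε : 0 < ε) (hd0 : 0 ≤ d)
    (hd : ∀ l p, (d ≤ |l| ∨ d ≤ |p|) → ‖w l p‖ ≤ ε * (V l + V p)) :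
    ∃ s, 0 ≤ s ∧ mass c - ε ^ 2 < s ∧ s ≤ mass c ∧
      M ≤ M * s ^ 2 + M * (1 - s) ^ 2 + 16 * ε * ∑' n, V n := by
  obtain ⟨hc, -⟩ := summable_of_tendsto hF hF1 hlim
  obtain ⟨N, hN⟩ := exists_Ioo_mass_lt hc (pow_pos hε 2)
  set A := Finset.Ioo (-N) N with hA
  set B := Finset.Ioo (-(N + 2 * d)) (N + 2 * d) with hB
  have hAB : A ⊆ B := Finset.Ioo_subset_Ioo (by omega) (by omega)
  set S := ∑' n, V n with hS
  have hS0 : 0 ≤ S := tsum_nonneg hV0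
  refine ⟨∑ n ∈ A, ‖c n‖ ^ 2, Finset.sum_nonneg fun _ _ => by positivity, hN, sum_le_mass hc A, ?_⟩
  -- The annulus `B \ A` has width `2 * d` on each side. It carries little mass of `c`, hence
  -- eventually of `F j`, so erasing it is cheap and creates the gap.
  have hann : ∑ n ∈ B \ A, ‖c n‖ ^ 2 < ε ^ 2 := by
    have h1 := Finset.sum_sdiff (f := fun n => ‖c n‖ ^ 2) hAB
    have h2 := sum_le_mass hc B
    linarith
  have hev := (tendsto_sum_sq hlim (B \ A)).eventually (gt_mem_nhds hann)
  have hA' := tendsto_sum_sq hlim A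
  have hlimit : Tendsto (fun j => M * (∑ n ∈ A, ‖F j n‖ ^ 2) ^ 2 +
      M * (1 - ∑ n ∈ A, ‖F j n‖ ^ 2) ^ 2 + 16 * ε * S) atTop
      (𝓝 (M * (∑ n ∈ A, ‖c n‖ ^ 2) ^ 2 + M * (1 - ∑ n ∈ A, ‖c n‖ ^ 2) ^ 2 + 16 * ε * S)) :=
    (((hA'.pow 2).const_mul M).add (((hA'.const_sub 1).pow 2).const_mul M)).add_const _
  refine le_of_tendsto_of_tendsto hFM hlimit ?_
  filter_upwards [hev] with j hj
  set g := restrictCompl (B \ A) (F j) with hg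
  have hgs : Summable fun n => ‖g n‖ ^ 2 := (hasSum_restrictCompl (B \ A) (hF j)).summable
  have hgm : mass g = 1 - ∑ n ∈ B \ A, ‖F j n‖ ^ 2 := by
    rw [hg, mass_restrictCompl _ (hF j), hF1]
  have hg1 : mass g ≤ 1 := by
    rw [hgm]; exact sub_le_self _ (Finset.sum_nonneg fun _ _ => by positivity)
  have hdiff : (fun n => F j n - g n) = restrict (B \ A) (F j) := by
    funext n
    by_cases hn : n ∈ B \ A <;> simp only [hg, restrict, restrictCompl, hn] <;> simp
  have hlip := norm_form_sub_le hV hV0 hw (hF j) hgs (hF1 j).le hg1 hε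
  rw [hdiff, mass_restrict] at hlip
  have hgA : ∀ n ∈ A, g n = F j n := fun n hn => by simp [hg, restrictCompl, hn]
  have hgap : ∀ n, N ≤ |n| → |n| < N + 2 * d → g n = 0 := fun n h1 h2 => by
    have : n ∈ B \ A := by
      rw [Finset.mem_sdiff, hA, hB, Finset.mem_Ioo, Finset.mem_Ioo, ← abs_lt, ← abs_lt]
      omega
    simp only [hg, restrictCompl, this, if_true]
  have hsep := form_truncate_separated hV hV0 hw d N hgs hgap
  have hxs := (hasSum_restrict A g).summable
  have hys := (hasSum_restrictCompl A hgs).summable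
  have hxm : mass (restrict A g) = ∑ n ∈ A, ‖F j n‖ ^ 2 := by
    rw [mass_restrict]
    exact Finset.sum_congr rfl fun n hn => by rw [hgA n hn]
  have hym : mass (restrictCompl A g) ≤ 1 - ∑ n ∈ A, ‖F j n‖ ^ 2 := by
    rw [mass_restrictCompl _ hgs, ← mass_restrict A g, hxm]
    linarith
  set a := ∑ n ∈ A, ‖F j n‖ ^ 2 with ha
  have ha0 : 0 ≤ a := Finset.sum_nonneg fun _ _ => by positivity
  have hy0 := mass_nonneg (restrictCompl A g)
  have ha1 : a ≤ 1 := by linarith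
  have hx := hM _ hxs
  have hy := hM _ hys
  have tg := norm_form_sub_truncate_le hV hV0 hw hε.le hd hgs
  have tx := norm_form_sub_truncate_le hV hV0 hw hε.le hd hxs
  have ty := norm_form_sub_truncate_le hV hV0 hw hε.le hd hys
  have re_le : ∀ z : ℂ, ∀ r : ℝ, ‖z‖ ≤ r → |z.re| ≤ r := fun z r h =>
    (Complex.abs_re_le_norm z).trans h
  have small : ∀ m : ℝ, 0 ≤ m → m ≤ 1 → 2 * ε * S * m ^ 2 ≤ 2 * ε * S := fun m h0 h1 =>
    mul_le_of_le_one_right (by positivity) (pow_le_one₀ h0 h1)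
  have tg' := abs_le.1 (re_le _ _ (tg.trans (small _ (mass_nonneg g) hg1)))
  have tx' := abs_le.1 (re_le _ _ (tx.trans (small _ (mass_nonneg _) (hxm.trans_le ha1))))
  have ty' := abs_le.1 (re_le _ _ (ty.trans (small _ hy0 (hym.trans (by linarith)))))
  -- Erasing costs `2 * S * (4 * ε + ε)`. Three truncation errors of `2 * ε * S` bring the total to
  -- the `16 * ε * S` of the statement.
  have hlip' : ‖form w (F j) - form w g‖ ≤ 10 * ε * S := by
    refine hlip.trans ?_
    have h1 : 4 * (∑ n ∈ B \ A, ‖F j n‖ ^ 2) / ε ≤ 4 * ε := by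
      rw [div_le_iff₀ hε]; linarith
    nlinarith [mul_le_mul_of_nonneg_left h1 hS0]
  have tl := abs_le.1 (re_le _ _ hlip')
  simp only [Complex.sub_re] at tg' tx' ty' tl
  have hsep' := congrArg Complex.re hsep
  rw [Complex.add_re] at hsep'
  rw [hxm] at hx
  have hy2 : M * mass (restrictCompl A g) ^ 2 ≤ M * (1 - a) ^ 2 :=
    mul_le_mul_of_nonneg_left (pow_le_pow_left₀ hy0 hym 2) hM0
  linarith [tg'.1, tg'.2, tx'.1, tx'.2, ty'.1, ty'.2, tl.1, tl.2]

/-- There is no loss of mass in the pointwise limit of a maximizing sequence. -/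
theorem mass_eq_one_of_pointwise_limit (hV : Summable V) (hV0 : ∀ n, 0 ≤ V n)
    (hw : ∀ l p, ‖w l p‖ ≤ V l + V p)
    (htail : ∀ ε > 0, ∃ d : ℤ, 0 ≤ d ∧ ∀ l p, (d ≤ |l| ∨ d ≤ |p|) → ‖w l p‖ ≤ ε * (V l + V p))
    (hM0 : 0 < M)
    (hM : ∀ f : ℤ → ℂ, (Summable fun n => ‖f n‖ ^ 2) → (form w f).re ≤ M * mass f ^ 2)
    (hF : ∀ j, Summable fun n => ‖F j n‖ ^ 2) (hF1 : ∀ j, mass (F j) = 1)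
    (hFM : Tendsto (fun j => (form w (F j)).re) atTop (𝓝 M))
    (hlim : ∀ n, Tendsto (fun j => F j n) atTop (𝓝 (c n))) (hc0 : 0 < mass c) : mass c = 1 := by
  obtain ⟨-, hc1⟩ := summable_of_tendsto hF hF1 hlim
  set S := ∑' n, V n with hS
  have hS0 : 0 ≤ S := tsum_nonneg hV0
  -- Since `1 - s² - (1 - s)² = 2 s (1 - s)`, the splitting bound reads `M s (1 - s) ≤ 8 ε S`. As `ε
  -- → 0` this forces `mass c` to be 0 or 1.
  have key : ∀ ε : ℝ, 0 < ε → ε < 1 → M * ((mass c - ε) * (1 - mass c)) ≤ 8 * ε * S := by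
    intro ε hε hε1
    obtain ⟨d, hd0, hd⟩ := htail ε hε
    obtain ⟨s, hs0, hs1, hs2, hs⟩ := le_of_pointwise_limit hV hV0 hw hM0.le hM hF hF1 hFM hlim hε hd0 hd
    have hs3 : mass c - ε ≤ s := by nlinarith
    have hs4 : (mass c - ε) * (1 - mass c) ≤ s * (1 - s) :=
      mul_le_mul hs3 (by linarith) (by linarith) hs0
    have := mul_le_mul_of_nonneg_left hs4 hM0.le
    nlinarith
  have h1 : Tendsto (fun ε : ℝ => M * ((mass c - ε) * (1 - mass c))) (𝓝[>] 0)
      (𝓝 (M * ((mass c - 0) * (1 - mass c)))) :=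
    (Continuous.tendsto (by fun_prop) 0).mono_left nhdsWithin_le_nhds
  have h2 : Tendsto (fun ε : ℝ => 8 * ε * S) (𝓝[>] 0) (𝓝 (8 * 0 * S)) :=
    (Continuous.tendsto (by fun_prop) 0).mono_left nhdsWithin_le_nhds
  have h3 := le_of_tendsto_of_tendsto h1 h2 (by
    filter_upwards [Ioo_mem_nhdsGT (show (0 : ℝ) < 1 by norm_num)] with ε hε
    exact key ε hε.1 hε.2)
  by_contra hne
  have h4 : 0 < 1 - mass c := sub_pos.2 (lt_of_le_of_ne hc1 hne)
  have h5 := mul_pos hM0 (mul_pos hc0 h4)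
  linarith

/-- Without loss of mass, the quartic form passes to the pointwise limit. -/
theorem le_form_of_pointwise_limit (hV : Summable V) (hV0 : ∀ n, 0 ≤ V n)
    (hw : ∀ l p, ‖w l p‖ ≤ V l + V p)
    (hF : ∀ j, Summable fun n => ‖F j n‖ ^ 2) (hF1 : ∀ j, mass (F j) = 1)
    (hFM : Tendsto (fun j => (form w (F j)).re) atTop (𝓝 M))
    (hlim : ∀ n, Tendsto (fun j => F j n) atTop (𝓝 (c n))) (hc1 : mass c = 1) :
    M ≤ (form w c).re := by
  obtain ⟨hc, -⟩ := summable_of_tendsto hF hF1 hlim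
  set S := ∑' n, V n with hS
  have hS0 : 0 ≤ S := tsum_nonneg hV0
  -- Equal total masses turn pointwise convergence into `ℓ²` convergence: eventually the squared
  -- distance is below `4 * ε ^ 2`, and the Lipschitz bound gives `2 * S * (16 * ε + ε)`.
  have key : ∀ ε : ℝ, 0 < ε → M ≤ (form w c).re + 34 * ε * S := by
    intro ε hε
    obtain ⟨N, hN⟩ := exists_Ioo_mass_lt hc (pow_pos hε 2)
    set A := Finset.Ioo (-N) N with hA
    have ht : Tendsto (fun j => ∑ n ∈ A, ‖F j n - c n‖ ^ 2 +
        2 * (1 - ∑ n ∈ A, ‖F j n‖ ^ 2) + 2 * (mass c - ∑ n ∈ A, ‖c n‖ ^ 2)) atTop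
        (𝓝 (∑ n ∈ A, ‖c n - c n‖ ^ 2 +
        2 * (1 - ∑ n ∈ A, ‖c n‖ ^ 2) + 2 * (mass c - ∑ n ∈ A, ‖c n‖ ^ 2))) :=
      ((tendsto_finsetSum _ fun n _ => (((hlim n).sub_const _).norm).pow 2).add
        (((tendsto_sum_sq hlim A).const_sub 1).const_mul 2)).add_const _
    have hlt : ∑ n ∈ A, ‖c n - c n‖ ^ 2 + 2 * (1 - ∑ n ∈ A, ‖c n‖ ^ 2) +
        2 * (mass c - ∑ n ∈ A, ‖c n‖ ^ 2) < 4 * ε ^ 2 := by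
      simp only [sub_self, norm_zero]
      simp only [ne_eq, OfNat.ofNat_ne_zero, not_false_eq_true, zero_pow, Finset.sum_const_zero]
      linarith
    refine le_of_tendsto hFM ?_
    filter_upwards [ht.eventually (gt_mem_nhds hlt)] with j hj
    have hE := mass_sub_le A (hF j) hc
    rw [hF1] at hE
    have hlip := norm_form_sub_le hV hV0 hw (hF j) hc (hF1 j).le hc1.le hε
    have h1 : 4 * mass (fun n => F j n - c n) / ε ≤ 16 * ε := by
      rw [div_le_iff₀ hε]; nlinarith
    have h2 := (Complex.abs_re_le_norm _).trans hlip
    rw [Complex.sub_re] at h2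
    have h3 := (abs_le.1 h2).2
    nlinarith [mul_le_mul_of_nonneg_left h1 hS0]
  have h2 : Tendsto (fun ε : ℝ => (form w c).re + 34 * ε * S) (𝓝[>] 0)
      (𝓝 ((form w c).re + 34 * 0 * S)) :=
    (Continuous.tendsto (by fun_prop) 0).mono_left nhdsWithin_le_nhds
  have h3 := ge_of_tendsto h2 (by
    filter_upwards [self_mem_nhdsWithin] with ε hε
    exact key ε hε)
  simpa using h3

/-- On unit vectors where the quartic form is bounded below, some coefficient is not small. -/
theorem exists_coefficient_bound (hV : Summable V) (hV0 : ∀ n, 0 ≤ V n)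
    (hw : ∀ l p, ‖w l p‖ ≤ V l + V p)
    (htail : ∀ ε > 0, ∃ d : ℤ, 0 ≤ d ∧ ∀ l p, (d ≤ |l| ∨ d ≤ |p|) → ‖w l p‖ ≤ ε * (V l + V p))
    {m : ℝ} (hm : 0 < m) :
    ∃ δ > 0, ∀ f : ℤ → ℂ, (Summable fun n => ‖f n‖ ^ 2) → mass f = 1 → m < (form w f).re →
      ∃ n, δ < ‖f n‖ := by
  set S := ∑' n, V n with hS
  have hS0 : 0 ≤ S := tsum_nonneg hV0
  -- This tolerance makes the truncation error at most `m / 2`; below, `δ` is chosen so that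
  -- uniformly small coefficients make the truncated form at most `m / 2` as well.
  obtain ⟨d, hd0, hd⟩ := htail (m / (4 * (S + 1))) (by positivity)
  have hC : ∀ l p, ‖w l p‖ ≤ 2 * S + 1 := fun l p => by
    have h1 := hV.le_tsum l fun _ _ => hV0 _
    have h2 := hV.le_tsum p fun _ _ => hV0 _
    linarith [hw l p]
  set K : ℝ := ((Finset.Ioo (-d) d).card : ℝ) ^ 2 with hK
  have hK0 : 0 ≤ K := by positivity
  set δ := Real.sqrt (m / (2 * ((2 * S + 1) * (K + 1)))) with hδ
  have hδ2 : δ ^ 2 = m / (2 * ((2 * S + 1) * (K + 1))) := Real.sq_sqrt (by positivity)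
  refine ⟨δ, Real.sqrt_pos.2 (by positivity), fun f hf hf1 hfm => ?_⟩
  by_contra hcon
  push Not at hcon
  have h1 := norm_form_truncate_le (w := w) d hC hf hcon
  have h2 := norm_form_sub_truncate_le hV hV0 hw (by positivity) hd hf
  rw [hf1] at h1 h2
  have h3 : (2 * S + 1) * δ ^ 2 * (K * 1) ≤ m / 2 := by
    rw [hδ2]
    have : (2 * S + 1) * (m / (2 * ((2 * S + 1) * (K + 1)))) * (K * 1) = m / 2 * (K / (K + 1)) := by
      field_simp
    rw [this]
    exact mul_le_of_le_one_right (by positivity) ((div_le_one (by positivity)).2 (by linarith))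
  have h4 : 2 * (m / (4 * (S + 1))) * S * 1 ^ 2 ≤ m / 2 := by
    have : 2 * (m / (4 * (S + 1))) * S * 1 ^ 2 = m / 2 * (S / (S + 1)) := by
      field_simp; ring
    rw [this]
    exact mul_le_of_le_one_right (by positivity) ((div_le_one (by positivity)).2 (by linarith))
  have h5 := (Complex.re_le_norm (form (truncate d w) f)).trans (h1.trans h3)
  have h6 := (Complex.re_le_norm (form w f - form (truncate d w) f)).trans (h2.trans h4)
  rw [Complex.sub_re] at h6
  linarith

/-- A maximizing sequence, translated so that its coefficient at 0 stays away from 0, has a nonzero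
pointwise limit along a subsequence. That limit keeps all the mass and attains the supremum. -/
theorem exists_maximizer (hV : Summable V) (hV0 : ∀ n, 0 ≤ V n)
    (hw : ∀ l p, ‖w l p‖ ≤ V l + V p)
    (htail : ∀ ε > 0, ∃ d : ℤ, 0 ≤ d ∧ ∀ l p, (d ≤ |l| ∨ d ≤ |p|) → ‖w l p‖ ≤ ε * (V l + V p))
    (hpos : ∃ f : ℤ → ℂ, (Summable fun n => ‖f n‖ ^ 2) ∧ 0 < (form w f).re) :
    ∃ c : ℤ → ℂ, (Summable fun n => ‖c n‖ ^ 2) ∧ mass c = 1 ∧ 0 < (form w c).re ∧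
      ∀ f : ℤ → ℂ, (Summable fun n => ‖f n‖ ^ 2) → (form w f).re ≤ (form w c).re * mass f ^ 2 := by
  set T : Set ℝ := {r | ∃ f : ℤ → ℂ, (Summable fun n => ‖f n‖ ^ 2) ∧ mass f = 1 ∧
    (form w f).re = r} with hT
  have hbound : ∀ f : ℤ → ℂ, (Summable fun n => ‖f n‖ ^ 2) →
      (form w f).re ≤ 2 * (∑' n, V n) * mass f ^ 2 := fun f hf =>
    (Complex.re_le_norm _).trans (norm_form_le hV hV0 hw hf)
  have hTb : BddAbove T := by
    refine ⟨2 * ∑' n, V n, ?_⟩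
    rintro r ⟨f, hf, hf1, rfl⟩
    simpa [hf1] using hbound f hf
  have hnormalize : ∀ f : ℤ → ℂ, (Summable fun n => ‖f n‖ ^ 2) → 0 < mass f →
      (form w f).re / mass f ^ 2 ∈ T := by
    intro f hf hf0
    refine ⟨fun n => ((Real.sqrt (mass f))⁻¹ : ℝ) * f n, ?_, ?_, ?_⟩
    · simp only [norm_mul, mul_pow]
      exact hf.mul_left _
    · rw [mass_smul, inv_pow, Real.sq_sqrt hf0.le, inv_mul_cancel₀ hf0.ne']
    · rw [form_smul, ← Complex.ofReal_pow, Complex.re_ofReal_mul, inv_pow,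
        show Real.sqrt (mass f) ^ 4 = (Real.sqrt (mass f) ^ 2) ^ 2 by ring, Real.sq_sqrt hf0.le]
      field_simp
  set M := sSup T with hMdef
  have hM : ∀ f : ℤ → ℂ, (Summable fun n => ‖f n‖ ^ 2) → (form w f).re ≤ M * mass f ^ 2 := by
    intro f hf
    rcases (mass_nonneg f).eq_or_lt with h0 | h0
    · have := hbound f hf
      rw [← h0] at this ⊢
      simpa using this
    · have := le_csSup hTb (hnormalize f hf h0)
      rwa [div_le_iff₀ (by positivity)] at this
  have hM0 : 0 < M := by
    obtain ⟨f, hf, hfp⟩ := hpos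
    by_contra hneg
    push Not at hneg
    have := hM f hf
    nlinarith [sq_nonneg (mass f)]
  -- The supremum of the empty set is 0 by convention, so `0 < M` gives nonemptiness.
  have hTne : T.Nonempty := by
    by_contra hne
    rw [Set.not_nonempty_iff_eq_empty] at hne
    rw [hMdef, hne, Real.sSup_empty] at hM0
    exact lt_irrefl _ hM0
  obtain ⟨δ, hδ0, hδ⟩ := exists_coefficient_bound hV hV0 hw htail (half_pos hM0)
  -- The error `M / 2 * (1 / (j + 1))` keeps every value above `M / 2`, the threshold for which `δ`
  -- was chosen; the large coefficient is moved to 0.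
  have hseq : ∀ j : ℕ, ∃ f : ℤ → ℂ, (Summable fun n => ‖f n‖ ^ 2) ∧ mass f = 1 ∧
      M - M / 2 * (1 / ((j : ℝ) + 1)) < (form w f).re ∧ δ < ‖f 0‖ := by
    intro j
    have hj : (0 : ℝ) < 1 / ((j : ℝ) + 1) := by positivity
    obtain ⟨_, ⟨f, hf, hf1, rfl⟩, hlt⟩ := exists_lt_of_lt_csSup hTne
      (show M - M / 2 * (1 / ((j : ℝ) + 1)) < sSup T from sub_lt_self _ (by positivity))
    have hj1 : 1 / ((j : ℝ) + 1) ≤ 1 := by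
      rw [div_le_one (by positivity)]; linarith [(Nat.cast_nonneg j : (0 : ℝ) ≤ j)]
    obtain ⟨k, hk⟩ := hδ f hf hf1 (by nlinarith)
    refine ⟨fun n => f (n + k), ?_, ?_, ?_, ?_⟩
    · exact (Equiv.addRight k).summable_iff.2 hf
    · rw [mass_shift, hf1]
    · rwa [form_shift]
    · simpa using hk
  choose F hF hF1 hFM hF0 using hseq
  have hFlim : Tendsto (fun j => (form w (F j)).re) atTop (𝓝 M) := by
    refine tendsto_of_tendsto_of_tendsto_of_le_of_le (g := fun j : ℕ => M - M / 2 * (1 / ((j : ℝ) + 1)))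
      (h := fun _ => M) ?_ tendsto_const_nhds (fun j => (hFM j).le) (fun j => ?_)
    · have := (tendsto_one_div_add_atTop_nhds_zero_nat (𝕜 := ℝ)).const_mul (M / 2)
      simpa using this.const_sub M
    · simpa [hF1] using hM (F j) (hF j)
  -- A countable product of discs is sequentially compact, which provides the pointwise limit.
  have hcomp : IsCompact (Set.univ.pi fun _ : ℤ => Metric.closedBall (0 : ℂ) 1) :=
    isCompact_univ_pi fun _ => isCompact_closedBall 0 1
  have hmem : ∀ j, F j ∈ Set.univ.pi fun _ : ℤ => Metric.closedBall (0 : ℂ) 1 := by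
    intro j n _
    rw [mem_closedBall_zero_iff]
    have := sq_le_mass (hF j) n
    rw [hF1] at this
    exact (sq_le_one_iff₀ (norm_nonneg _)).1 this
  obtain ⟨c, -, φ, hφ, hlim⟩ := hcomp.tendsto_subseq hmem
  have hlim' : ∀ n, Tendsto (fun j => F (φ j) n) atTop (𝓝 (c n)) := fun n =>
    (tendsto_pi_nhds.1 hlim) n
  have hFlim' := hFlim.comp hφ.tendsto_atTop
  obtain ⟨hc, -⟩ := summable_of_tendsto (fun j => hF (φ j)) (fun j => hF1 (φ j)) hlim'
  have hc0 : δ ≤ ‖c 0‖ :=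
    ge_of_tendsto (hlim' 0).norm (Eventually.of_forall fun j => (hF0 (φ j)).le)
  have hcm : 0 < mass c := lt_of_lt_of_le (pow_pos (hδ0.trans_le hc0) 2) (sq_le_mass hc 0)
  have hc1 := mass_eq_one_of_pointwise_limit hV hV0 hw htail hM0 hM (fun j => hF (φ j))
    (fun j => hF1 (φ j)) hFlim' hlim' hcm
  have hcM := le_form_of_pointwise_limit hV hV0 hw (fun j => hF (φ j)) (fun j => hF1 (φ j))
    hFlim' hlim' hc1
  exact ⟨c, hc, hc1, hM0.trans_le hcM, fun f hf =>
    (hM f hf).trans (mul_le_mul_of_nonneg_right hcM (sq_nonneg _))⟩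

end Maximizer

/-! ### The kernels for `B = π / 2`: decay, sign and a positive test value. -/

section Kernel

/-- A summable weight that dominates the kernels below. -/
def weight (n : ℤ) : ℝ := (|(n : ℝ)| ^ (-(1 / 4) : ℝ)) ^ 6 + if n = 0 then 1 else 0

theorem weight_nonneg (n : ℤ) : 0 ≤ weight n := by
  unfold weight
  split_ifs <;> positivity

theorem pow_six_le_weight (n : ℤ) : (|(n : ℝ)| ^ (-(1 / 4) : ℝ)) ^ 6 ≤ weight n := by
  unfold weight
  split_ifs <;> simp

/-- The power in `weight` is 0 at `n = 0` by convention; the indicator is there to dominate kernels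
equal to `±1` on the axes or at the origin. -/
theorem one_le_weight_zero : 1 ≤ weight 0 := by
  unfold weight
  rw [if_pos rfl]
  linarith [show 0 ≤ (|((0 : ℤ) : ℝ)| ^ (-(1 / 4) : ℝ)) ^ 6 by positivity]

theorem summable_weight : Summable weight := by
  unfold weight
  refine Summable.add ?_ (summable_of_ne_finset_zero (s := {0}) fun b hb => if_neg (by simpa using hb))
  refine (Real.summable_abs_int_rpow (b := 3 / 2) (by norm_num)).congr fun n => ?_
  rw [← Real.rpow_natCast, ← Real.rpow_mul (abs_nonneg _)]
  norm_num

/-- The kernel of the functional `D` for `B = π / 2`. -/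
def oddKernel (l p : ℤ) : ℂ := if Odd l ∧ Odd p then -(2 * Complex.I) / (Real.pi * l * p) else 0

/-- In terms of `a` and `b` the norm is `(2 / π) a⁴ b⁴`, and `a³ b³ ≤ a⁶ + b⁶` is summable in the
required sense. The spare factor `a b` supplies the smallness at infinity. -/
theorem norm_oddKernel_le_mul {l p : ℤ} {a b : ℝ} (hl : Odd l) (hp : Odd p)
    (ha : |(l : ℝ)| ^ (-(1 / 4) : ℝ) = a) (hb : |(p : ℝ)| ^ (-(1 / 4) : ℝ) = b) :
    0 < a ∧ a ≤ 1 ∧ 0 < b ∧ b ≤ 1 ∧ ‖oddKernel l p‖ ≤ a * b * (weight l + weight p) := by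
  have pos : ∀ n : ℤ, Odd n → (1 : ℝ) ≤ |(n : ℝ)| := fun n hn => by
    have h1 : 1 ≤ |n| := Int.one_le_abs (by rintro rfl; simp at hn)
    exact_mod_cast h1
  have h1 := pos l hl
  have h2 := pos p hp
  have four : ∀ x : ℝ, 0 ≤ x → (x ^ (-(1 / 4) : ℝ)) ^ 4 = x⁻¹ := fun x hx => by
    rw [← Real.rpow_natCast, ← Real.rpow_mul hx]
    norm_num
    exact Real.rpow_neg_one x
  have ha0 : 0 < a := ha ▸ Real.rpow_pos_of_pos (by linarith) _
  have hb0 : 0 < b := hb ▸ Real.rpow_pos_of_pos (by linarith) _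
  have ha1 : a ≤ 1 := ha ▸ Real.rpow_le_one_of_one_le_of_nonpos h1 (by norm_num)
  have hb1 : b ≤ 1 := hb ▸ Real.rpow_le_one_of_one_le_of_nonpos h2 (by norm_num)
  refine ⟨ha0, ha1, hb0, hb1, ?_⟩
  have e : ‖oddKernel l p‖ = 2 / Real.pi * (a ^ 4 * b ^ 4) := by
    rw [oddKernel, if_pos ⟨hl, hp⟩, ← ha, ← hb, four _ (abs_nonneg _), four _ (abs_nonneg _)]
    simp [abs_of_pos Real.pi_pos]
    field_simp
  rw [e]
  have hpi : 2 / Real.pi ≤ 1 := (div_le_one Real.pi_pos).2 Real.two_le_pi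
  have h3 : 2 / Real.pi * (a ^ 4 * b ^ 4) ≤ a ^ 4 * b ^ 4 :=
    mul_le_of_le_one_left (by positivity) hpi
  have h4 : a ^ 4 * b ^ 4 ≤ a * b * (a ^ 6 + b ^ 6) := by
    have : a ^ 3 * b ^ 3 ≤ a ^ 6 + b ^ 6 := by
      nlinarith [sq_nonneg (a ^ 3 - b ^ 3), sq_nonneg (a ^ 3), sq_nonneg (b ^ 3)]
    calc a ^ 4 * b ^ 4 = a * b * (a ^ 3 * b ^ 3) := by ring
      _ ≤ _ := mul_le_mul_of_nonneg_left this (by positivity)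
  have h5 := pow_six_le_weight l
  have h6 := pow_six_le_weight p
  rw [ha] at h5
  rw [hb] at h6
  exact h3.trans (h4.trans (mul_le_mul_of_nonneg_left (add_le_add h5 h6) (by positivity)))

theorem norm_oddKernel_le (l p : ℤ) : ‖oddKernel l p‖ ≤ weight l + weight p := by
  by_cases h : Odd l ∧ Odd p
  · obtain ⟨ha0, ha1, hb0, hb1, hle⟩ := norm_oddKernel_le_mul h.1 h.2 rfl rfl
    exact hle.trans (mul_le_of_le_one_left (add_nonneg (weight_nonneg l) (weight_nonneg p))
      (mul_le_one₀ ha1 hb0.le hb1))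
  · rw [oddKernel, if_neg h, norm_zero]
    exact add_nonneg (weight_nonneg l) (weight_nonneg p)

theorem exists_norm_oddKernel_le {ε : ℝ} (hε : 0 < ε) : ∃ d : ℤ, 1 ≤ d ∧
    ∀ l p, (d ≤ |l| ∨ d ≤ |p|) → ‖oddKernel l p‖ ≤ ε * (weight l + weight p) := by
  have ht := (tendsto_rpow_neg_atTop (y := 1 / 4) (by norm_num)).comp
    (tendsto_natCast_atTop_atTop (R := ℝ))
  obtain ⟨m, hm, hm1⟩ := ((ht.eventually (gt_mem_nhds hε)).and (Filter.eventually_ge_atTop 1)).exists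
  simp only [Function.comp] at hm
  refine ⟨m, by exact_mod_cast hm1, fun l p hlp => ?_⟩
  have hwt := add_nonneg (weight_nonneg l) (weight_nonneg p)
  by_cases h : Odd l ∧ Odd p
  · obtain ⟨ha0, ha1, hb0, hb1, hle⟩ := norm_oddKernel_le_mul h.1 h.2 rfl rfl
    refine hle.trans (mul_le_mul_of_nonneg_right ?_ hwt)
    have key : ∀ n : ℤ, (m : ℤ) ≤ |n| → |(n : ℝ)| ^ (-(1 / 4) : ℝ) ≤ ε := fun n hn => by
      have h1 : (m : ℝ) ≤ |(n : ℝ)| := by exact_mod_cast hn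
      have h2 : (0 : ℝ) < m := by exact_mod_cast hm1
      exact (Real.rpow_le_rpow_of_nonpos h2 h1 (by norm_num)).trans hm.le
    rcases hlp with h1 | h1
    · exact (mul_le_of_le_one_right ha0.le hb1).trans (key l h1)
    · exact (mul_le_of_le_one_left hb0.le ha1).trans (key p h1)
  · rw [oddKernel, if_neg h, norm_zero]
    exact mul_nonneg hε.le hwt

/-- The kernel of the `ℓ⁴` norm. -/
def diagKernel (l p : ℤ) : ℂ := if l = 0 ∧ p = 0 then 1 else 0

/-- The kernel of the functional `A` for `B = π / 2`. -/
def kernel (l p : ℤ) : ℂ := oddKernel l p - diagKernel l p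

theorem norm_diagKernel_le (l p : ℤ) : ‖diagKernel l p‖ ≤ weight l + weight p := by
  unfold diagKernel
  split_ifs with h
  · rw [h.1, norm_one]
    linarith [one_le_weight_zero, weight_nonneg p]
  · rw [norm_zero]
    exact add_nonneg (weight_nonneg l) (weight_nonneg p)

theorem kernel_eq_oddKernel {l p : ℤ} (h : ¬ (l = 0 ∧ p = 0)) : kernel l p = oddKernel l p := by
  rw [kernel, diagKernel, if_neg h, sub_zero]

theorem kernel_zero : kernel 0 0 = -1 := by simp [kernel, oddKernel, diagKernel]

theorem norm_kernel_le (l p : ℤ) : ‖kernel l p‖ ≤ weight l + weight p := by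
  by_cases h : l = 0 ∧ p = 0
  · rw [h.1, h.2, kernel_zero, norm_neg, norm_one]
    linarith [one_le_weight_zero]
  · rw [kernel_eq_oddKernel h]
    exact norm_oddKernel_le l p

theorem exists_norm_kernel_le {ε : ℝ} (hε : 0 < ε) : ∃ d : ℤ, 0 ≤ d ∧
    ∀ l p, (d ≤ |l| ∨ d ≤ |p|) → ‖kernel l p‖ ≤ ε * (weight l + weight p) := by
  obtain ⟨d, hd1, hd⟩ := exists_norm_oddKernel_le hε
  refine ⟨d, by omega, fun l p hlp => ?_⟩
  have : ¬ (l = 0 ∧ p = 0) := by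
    rintro ⟨rfl, rfl⟩
    rw [abs_zero] at hlp
    omega
  rw [kernel_eq_oddKernel this]
  exact hd l p hlp

/-- Four consecutive coefficients at which the functional `A` is positive. -/
def testSequence (n : ℤ) : ℂ :=
  if n = 0 then 1 else if n = 1 then 1 else if n = 2 then Complex.I else
    if n = 3 then -Complex.I else 0

theorem testSequence_eq_zero {n : ℤ} (hn : ¬ (0 ≤ n ∧ n ≤ 3)) : testSequence n = 0 := by
  unfold testSequence
  rw [if_neg (by omega), if_neg (by omega), if_neg (by omega), if_neg (by omega)]

theorem summable_testSequence : Summable fun n => ‖testSequence n‖ ^ 2 :=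
  summable_of_ne_finset_zero (s := Finset.Icc 0 3) fun n hn => by
    rw [testSequence_eq_zero (by simpa using hn)]; simp

/-- On four consecutive indices only `l, p = ±1` survive in the odd part. The phases are such that
each of the eight terms equals `2 / π`; the four diagonal terms give `-4`. -/
theorem form_kernel_testSequence : form kernel testSequence = 16 / Real.pi - 4 := by
  have hsupp : ∀ i : ℤ × ℤ × ℤ, i ∉ ({(1, 2, 1), (1, 3, 1), (-1, 0, -1), (-1, 1, -1), (1, 1, -1),
      (1, 2, -1), (-1, 1, 1), (-1, 2, 1), (0, 0, 0), (0, 1, 0), (0, 2, 0), (0, 3, 0)} :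
      Finset (ℤ × ℤ × ℤ)) → kernel i.1 i.2.2 * quad testSequence i = 0 := by
    rintro ⟨l, n, p⟩ hi
    by_contra hne
    obtain ⟨hk, hq⟩ := mul_ne_zero_iff.1 hne
    have h4 : testSequence n ≠ 0 ∧ testSequence (n - l) ≠ 0 ∧ testSequence (n - p) ≠ 0 ∧
        testSequence (n - p - l) ≠ 0 := by
      simpa [quad, and_assoc] using hq
    have h1 := not_imp_comm.1 testSequence_eq_zero h4.1
    have h2 := not_imp_comm.1 testSequence_eq_zero h4.2.1
    have h3 := not_imp_comm.1 testSequence_eq_zero h4.2.2.1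
    have h5 := not_imp_comm.1 testSequence_eq_zero h4.2.2.2
    have hlp : (l = 0 ∧ p = 0) ∨ (l % 2 = 1 ∧ p % 2 = 1) := by
      by_contra hcon
      push Not at hcon
      refine hk ?_
      rw [kernel_eq_oddKernel fun h => hcon.1 h.1 h.2, oddKernel, if_neg]
      rw [Int.odd_iff, Int.odd_iff]
      exact fun h => hcon.2 h.1 h.2
    obtain ⟨hn0, hn3⟩ := h1
    rcases hlp with ⟨rfl, rfl⟩ | ⟨hl, hp⟩
    · interval_cases n <;> simp at hi
    · have hl' : l = 1 ∨ l = -1 := by omega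
      have hp' : p = 1 ∨ p = -1 := by omega
      rcases hl' with rfl | rfl <;> rcases hp' with rfl | rfl <;> interval_cases n <;>
        first | (simp at hi; done) | omega
  have k11 : kernel 1 1 = -(2 * Complex.I) / Real.pi := by
    rw [kernel_eq_oddKernel (by norm_num), oddKernel, if_pos (by decide)]; simp
  have k22 : kernel (-1) (-1) = -(2 * Complex.I) / Real.pi := by
    rw [kernel_eq_oddKernel (by norm_num), oddKernel, if_pos (by decide)]; simp
  have k12 : kernel 1 (-1) = 2 * Complex.I / Real.pi := by
    rw [kernel_eq_oddKernel (by norm_num), oddKernel, if_pos (by decide)]; simp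
  have k21 : kernel (-1) 1 = 2 * Complex.I / Real.pi := by
    rw [kernel_eq_oddKernel (by norm_num), oddKernel, if_pos (by decide)]; simp
  rw [form, tsum_eq_sum fun i hi => hsupp i hi]
  have t0 : testSequence 0 = 1 := by simp [testSequence]
  have t1 : testSequence 1 = 1 := by simp [testSequence]
  have t2 : testSequence 2 = Complex.I := by simp [testSequence]
  have t3 : testSequence 3 = -Complex.I := by simp [testSequence]
  repeat rw [Finset.sum_insert (by decide)]
  rw [Finset.sum_singleton]
  simp only [quad, k11, k22, k12, k21, kernel_zero]
  norm_num [t0, t1, t2, t3]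
  have hpi : (Real.pi : ℂ) ≠ 0 := Complex.ofReal_ne_zero.2 Real.pi_ne_zero
  field_simp
  ring_nf
  simp [Complex.I_sq]

/-- The involution `e` exchanges `n` with `n - l` and `n - p` with `n - p - l`. Without conjugations
the product is unchanged, while the kernel changes sign with `l`. -/
theorem form_oddKernel_eq_zero {f : ℤ → ℂ} (hf : ∀ n, (f n).im = 0) : form oddKernel f = 0 := by
  let e : ℤ × ℤ × ℤ ≃ ℤ × ℤ × ℤ :=
    { toFun := fun i => (-i.1, i.2.1 - i.1, i.2.2)
      invFun := fun i => (-i.1, i.2.1 - i.1, i.2.2)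
      left_inv := fun i => by ext <;> simp
      right_inv := fun i => by ext <;> simp }
  have hconj : ∀ n, conj (f n) = f n := fun n => Complex.conj_eq_iff_im.2 (hf n)
  have h : form oddKernel f = -form oddKernel f := by
    conv_lhs => rw [form, ← e.tsum_eq (fun i => oddKernel i.1 i.2.2 * quad f i)]
    rw [form, ← tsum_neg]
    refine tsum_congr fun i => ?_
    have h1 : oddKernel (-i.1) i.2.2 = -oddKernel i.1 i.2.2 := by
      unfold oddKernel
      simp only [odd_neg]
      split_ifs
      · push_cast
        rw [mul_neg, neg_mul, div_neg]
      · simp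
    have h2 : quad f (-i.1, i.2.1 - i.1, i.2.2) = quad f i := by
      simp only [quad, hconj]
      rw [show i.2.1 - i.1 - -i.1 = i.2.1 by ring,
        show i.2.1 - i.1 - i.2.2 - -i.1 = i.2.1 - i.2.2 by ring,
        show i.2.1 - i.1 - i.2.2 = i.2.1 - i.2.2 - i.1 by ring]
      ring
    simp only [e, Equiv.coe_fn_mk]
    rw [h1, h2, neg_mul]
  exact self_eq_neg.1 h

theorem re_form_kernel_nonpos {f : ℤ → ℂ} (hfs : Summable fun n => ‖f n‖ ^ 2)
    (hf : ∀ n, (f n).im = 0) : (form kernel f).re ≤ 0 := by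
  have h1 := summable_form summable_weight weight_nonneg norm_oddKernel_le hfs
  have h2 := summable_form summable_weight weight_nonneg norm_diagKernel_le hfs
  have h3 : form kernel f = form oddKernel f - form diagKernel f := by
    rw [form, form, form, ← h1.tsum_sub h2]
    exact tsum_congr fun i => by rw [kernel, sub_mul]
  rw [h3, form_oddKernel_eq_zero hf, zero_sub, Complex.neg_re, neg_nonpos, form, Complex.re_tsum h2]
  refine tsum_nonneg fun i => ?_
  unfold diagKernel
  split_ifs with hi
  · have : quad f i = ((‖f i.2.1‖ ^ 4 : ℝ) : ℂ) := by
      rw [quad, hi.1, hi.2, sub_zero, sub_zero, Complex.mul_conj, mul_assoc, mul_comm (conj _),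
        Complex.mul_conj, Complex.normSq_eq_norm_sq]
      push_cast
      ring
    rw [one_mul, this, Complex.ofReal_re]
    positivity
  · simp

theorem exists_maximizer_kernel :
    ∃ c : ℤ → ℂ, (Summable fun n => ‖c n‖ ^ 2) ∧ mass c = 1 ∧ 0 < (form kernel c).re ∧
      ∀ f : ℤ → ℂ, (Summable fun n => ‖f n‖ ^ 2) →
        (form kernel f).re ≤ (form kernel c).re * mass f ^ 2 := by
  refine exists_maximizer summable_weight weight_nonneg norm_kernel_le
    (fun ε hε => exists_norm_kernel_le hε) ⟨testSequence, summable_testSequence, ?_⟩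
  have h : (16 / Real.pi - 4 : ℂ) = ((16 / Real.pi - 4 : ℝ) : ℂ) := by push_cast; rfl
  rw [form_kernel_testSequence, h, Complex.ofReal_re, sub_pos, lt_div_iff₀ Real.pi_pos]
  linarith [Real.pi_lt_four]

end Kernel

/-! ### Time averages and the phase kernel. -/

section Time

theorem hasSum_of_terms_eq {ι : Type*} {f g : ι → ℂ} {a : ℂ} (h : HasSum f a)
    (hfg : ∀ i, f i = g i) : HasSum g a :=
  (funext hfg : f = g) ▸ h

theorem norm_exp_neg_I_mul (x : ℝ) : ‖Complex.exp (-Complex.I * x)‖ = 1 := by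
  simp [Complex.norm_exp]

/-- The time average of an almost periodic function, by expanding the square. -/
theorem integral_norm_sq_tsum {a : ℤ → ℂ} (ha : Summable fun n => ‖a n‖) (ω : ℤ → ℝ) :
    ((∫ t in (0 : ℝ)..1, ‖∑' n, Complex.exp (-Complex.I * (ω n * t : ℝ)) * a n‖ ^ 2 : ℝ) : ℂ) =
      ∑' i : ℤ × ℤ, (∫ t in (0 : ℝ)..1, Complex.exp (-Complex.I * ((ω i.1 - ω i.2) * t : ℝ))) *
        (a i.1 * conj (a i.2)) := by
  have hb : Summable fun i : ℤ × ℤ => ‖a i.1‖ * ‖a i.2‖ :=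
    ha.mul_of_nonneg ha (fun _ => norm_nonneg _) (fun _ => norm_nonneg _)
  have hsum : ∀ t : ℝ, Summable fun n => ‖Complex.exp (-Complex.I * (ω n * t : ℝ)) * a n‖ :=
    fun t => by simpa only [norm_mul, norm_exp_neg_I_mul, one_mul] using ha
  have h := intervalIntegral.hasSum_integral_of_dominated_convergence (μ := volume) (a := 0) (b := 1)
    (F := fun (i : ℤ × ℤ) (t : ℝ) =>
      Complex.exp (-Complex.I * ((ω i.1 - ω i.2) * t : ℝ)) * (a i.1 * conj (a i.2)))
    (f := fun t => ((‖∑' n, Complex.exp (-Complex.I * (ω n * t : ℝ)) * a n‖ ^ 2 : ℝ) : ℂ))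
    (fun i _ => ‖a i.1‖ * ‖a i.2‖) (fun i => ?_) (fun i => ?_) ?_ ?_ ?_
  · rw [← intervalIntegral.integral_ofReal, ← h.tsum_eq]
    exact tsum_congr fun i => intervalIntegral.integral_mul_const _ _
  · exact Continuous.aestronglyMeasurable (by fun_prop)
  · refine Filter.Eventually.of_forall fun t _ => ?_
    rw [norm_mul, norm_exp_neg_I_mul, norm_mul, RCLike.norm_conj, one_mul]
  · exact Filter.Eventually.of_forall fun t _ => hb
  · exact intervalIntegrable_const
  · refine Filter.Eventually.of_forall fun t _ => ?_
    have h1 := (hsum t).of_norm.hasSum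
    have h2 := h1.mul (h1.map (starRingEnd ℂ) Complex.continuous_conj)
      (by
        refine Summable.of_norm ?_
        simpa only [Function.comp, norm_mul, RCLike.norm_conj, norm_exp_neg_I_mul, one_mul] using hb)
    rw [Complex.mul_conj, Complex.normSq_eq_norm_sq] at h2
    refine hasSum_of_terms_eq h2 fun i => ?_
    have h3 : Complex.exp (-Complex.I * ((ω i.1 - ω i.2) * t : ℝ)) =
        Complex.exp (-Complex.I * (ω i.1 * t : ℝ)) *
          conj (Complex.exp (-Complex.I * (ω i.2 * t : ℝ))) := by
      rw [← Complex.exp_conj, ← Complex.exp_add]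
      congr 1
      simp only [map_mul, map_neg, Complex.conj_I, Complex.conj_ofReal]
      push_cast
      ring
    rw [h3]
    simp only [Function.comp, map_mul]
    ring

theorem continuous_tsum_exp {a : ℤ → ℂ} (ha : Summable fun n => ‖a n‖) (ω : ℤ → ℝ) :
    Continuous fun t : ℝ => ∑' n, Complex.exp (-Complex.I * (ω n * t : ℝ)) * a n :=
  continuous_tsum (fun n => by fun_prop) ha fun n t => by
    rw [norm_mul, norm_exp_neg_I_mul, one_mul]

theorem lintegral_enorm_sq_tsum {a : ℤ → ℂ} (ha : Summable fun n => ‖a n‖) (ω : ℤ → ℝ) :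
    ∫⁻ t in Set.Icc (0 : ℝ) 1, ‖∑' n, Complex.exp (-Complex.I * (ω n * t : ℝ)) * a n‖ₑ ^ 2 =
      ENNReal.ofReal
        (∫ t in (0 : ℝ)..1, ‖∑' n, Complex.exp (-Complex.I * (ω n * t : ℝ)) * a n‖ ^ 2) := by
  have hc := continuous_tsum_exp ha ω
  have hint : IntegrableOn
      (fun t : ℝ => ‖∑' n, Complex.exp (-Complex.I * (ω n * t : ℝ)) * a n‖ ^ 2) (Set.Icc 0 1) :=
    (hc.norm.pow 2).continuousOn.integrableOn_Icc
  rw [intervalIntegral.integral_of_le zero_le_one, ← integral_Icc_eq_integral_Ioc,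
    ofReal_integral_eq_lintegral_ofReal hint (ae_of_all _ fun t => by positivity)]
  refine lintegral_congr fun t => ?_
  rw [ENNReal.ofReal_pow (norm_nonneg _), ofReal_norm]

/-- The kernel of the space-time integral for `B = π / 2`. -/
def phaseKernel (l p : ℤ) : ℂ :=
  ∫ t in (0 : ℝ)..1, Complex.exp (-Complex.I * ((Real.pi * (l * p : ℤ)) * t : ℝ))

theorem exp_neg_I_mul_pi (k : ℤ) :
    Complex.exp (-Complex.I * (Real.pi * k : ℝ)) = if Odd k then -1 else 1 := by
  have h : Complex.exp (-Complex.I * (Real.pi * k : ℝ)) = (-1 : ℂ) ^ (-k) := by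
    rw [← Complex.exp_pi_mul_I, ← Complex.exp_int_mul]
    congr 1
    push_cast
    ring
  rw [h]
  split_ifs with hk
  · exact Odd.neg_one_zpow (odd_neg.2 hk)
  · exact Even.neg_one_zpow (even_neg.2 (Int.not_odd_iff_even.1 hk))

/-- The exponential is `(-1)^(l p)`, so the numerator is `-2` when both indices are odd and 0
otherwise. Both `phaseKernel` and `dTerm` reduce to this quotient. -/
theorem exp_sub_one_div {l p : ℤ} (hl : l ≠ 0) (hp : p ≠ 0) :
    (Complex.exp (-Complex.I * (Real.pi * (l * p : ℤ) : ℝ)) - 1) /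
      (-Complex.I * (Real.pi * (l * p : ℤ) : ℝ)) = oddKernel l p := by
  rw [exp_neg_I_mul_pi, oddKernel]
  have hpi : (Real.pi : ℂ) ≠ 0 := Complex.ofReal_ne_zero.2 Real.pi_ne_zero
  have hl' : (l : ℂ) ≠ 0 := Int.cast_ne_zero.2 hl
  have hp' : (p : ℂ) ≠ 0 := Int.cast_ne_zero.2 hp
  simp only [Int.odd_mul]
  split_ifs
  · push_cast
    field_simp
    rw [Complex.I_sq]
    norm_num
  · simp

theorem phaseKernel_eq {l p : ℤ} (hl : l ≠ 0) (hp : p ≠ 0) : phaseKernel l p = oddKernel l p := by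
  have hc : -Complex.I * (Real.pi * (l * p : ℤ) : ℝ) ≠ 0 :=
    mul_ne_zero (neg_ne_zero.2 Complex.I_ne_zero) (Complex.ofReal_ne_zero.2
      (mul_ne_zero Real.pi_ne_zero (Int.cast_ne_zero.2 (mul_ne_zero hl hp))))
  rw [phaseKernel, ← exp_sub_one_div hl hp]
  have h := integral_exp_mul_complex (a := 0) (b := 1) hc
  rw [Complex.ofReal_one, mul_one, Complex.ofReal_zero, mul_zero, Complex.exp_zero] at h
  rw [← h]
  congr 1
  funext t
  push_cast
  ring_nf

theorem phaseKernel_eq_one {l p : ℤ} (h : l = 0 ∨ p = 0) : phaseKernel l p = 1 := by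
  have h0 : l * p = 0 := mul_eq_zero.2 h
  simp [phaseKernel, h0]

/-- The kernel which keeps the indices with `l = 0`. -/
def leftKernel (l _p : ℤ) : ℂ := if l = 0 then 1 else 0

/-- The kernel which keeps the indices with `p = 0`. -/
def rightKernel (_l p : ℤ) : ℂ := if p = 0 then 1 else 0

/-- Inclusion-exclusion on the axes: the origin is counted by both `leftKernel` and `rightKernel`,
and the `-1` in `kernel` corrects this. -/
theorem phaseKernel_decomposition (l p : ℤ) :
    phaseKernel l p = leftKernel l p + rightKernel l p + kernel l p := by
  by_cases hl : l = 0
  · rw [phaseKernel_eq_one (Or.inl hl)]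
    by_cases hp : p = 0 <;> simp [leftKernel, rightKernel, kernel, oddKernel, diagKernel, hl, hp]
  · by_cases hp : p = 0
    · rw [phaseKernel_eq_one (Or.inr hp)]
      simp [leftKernel, rightKernel, kernel, oddKernel, diagKernel, hl, hp]
    · rw [phaseKernel_eq hl hp]
      simp [leftKernel, rightKernel, kernel, diagKernel, hl, hp]

theorem norm_phaseKernel_le (l p : ℤ) : ‖phaseKernel l p‖ ≤ weight l + weight p := by
  by_cases h : l = 0 ∨ p = 0
  · rw [phaseKernel_eq_one h, norm_one]
    have := one_le_weight_zero
    rcases h with rfl | rfl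
    · linarith [weight_nonneg p]
    · linarith [weight_nonneg l]
  · push Not at h
    rw [phaseKernel_eq h.1 h.2]
    exact norm_oddKernel_le l p

variable {f : ℤ → ℂ}

theorem hasSum_indicator_mul_mass (hf : Summable fun n => ‖f n‖ ^ 2) :
    HasSum (fun i : ℤ × ℤ × ℤ =>
      (((if i.1 = 0 then 1 else 0) * (‖f i.2.1‖ ^ 2 * ‖f i.2.2‖ ^ 2) : ℝ) : ℂ))
      ((mass f ^ 2 : ℝ) : ℂ) := by
  have h1 : HasSum (fun n : ℤ => if n = 0 then (1 : ℝ) else 0) 1 := by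
    simpa using hasSum_ite_eq (0 : ℤ) (1 : ℝ)
  have h := hasSum_triple h1.summable hf hf (fun n => by split_ifs <;> norm_num)
    (fun n => by positivity) (fun n => by positivity)
  rw [h1.tsum_eq, one_mul, ← mass.eq_def, ← sq] at h
  exact Complex.hasSum_ofReal.2 h

theorem hasSum_leftKernel (hf : Summable fun n => ‖f n‖ ^ 2) :
    HasSum (fun i : ℤ × ℤ × ℤ => leftKernel i.1 i.2.2 * quad f i) ((mass f ^ 2 : ℝ) : ℂ) := by
  refine hasSum_of_terms_eq (innerLeft.hasSum_iff.2 (hasSum_indicator_mul_mass hf)) fun i => ?_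
  change (((if i.1 = 0 then 1 else 0) * (‖f (i.2.1 - i.1)‖ ^ 2 * ‖f (i.2.1 - i.2.2)‖ ^ 2) : ℝ) : ℂ) =
    (if i.1 = 0 then 1 else 0) * quad f i
  split_ifs with h
  · rw [quad, h, sub_zero, sub_zero, one_mul, one_mul, Complex.mul_conj, mul_assoc,
      mul_comm (conj _), Complex.mul_conj, Complex.normSq_eq_norm_sq, Complex.normSq_eq_norm_sq]
    push_cast
    rfl
  · simp

theorem hasSum_rightKernel (hf : Summable fun n => ‖f n‖ ^ 2) :
    HasSum (fun i : ℤ × ℤ × ℤ => rightKernel i.1 i.2.2 * quad f i) ((mass f ^ 2 : ℝ) : ℂ) := by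
  refine hasSum_of_terms_eq (innerRight.hasSum_iff.2 (hasSum_indicator_mul_mass hf)) fun i => ?_
  change (((if i.2.2 = 0 then 1 else 0) * (‖f (i.2.1 - i.1)‖ ^ 2 * ‖f (i.2.1 - i.2.2)‖ ^ 2) : ℝ) : ℂ) =
    (if i.2.2 = 0 then 1 else 0) * quad f i
  split_ifs with h
  · have e : quad f i = (f (i.2.1 - i.1) * conj (f (i.2.1 - i.1))) * (f i.2.1 * conj (f i.2.1)) := by
      rw [quad, h, sub_zero]
      ring
    rw [e, h, sub_zero, Complex.mul_conj, Complex.mul_conj, Complex.normSq_eq_norm_sq,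
      Complex.normSq_eq_norm_sq]
    push_cast
    ring
  · simp

/-- Each axis makes the quartic product a product of two squared moduli and contributes `mass f ^
2`, which is fixed by the constraint. -/
theorem form_phaseKernel (hf : Summable fun n => ‖f n‖ ^ 2) :
    form phaseKernel f = ((2 * mass f ^ 2 : ℝ) : ℂ) + form kernel f := by
  have h := ((hasSum_leftKernel hf).add (hasSum_rightKernel hf)).add
    (summable_form summable_weight weight_nonneg norm_kernel_le hf).hasSum
  rw [form]
  have e : (fun i : ℤ × ℤ × ℤ => phaseKernel i.1 i.2.2 * quad f i) = fun i =>
      leftKernel i.1 i.2.2 * quad f i + rightKernel i.1 i.2.2 * quad f i +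
        kernel i.1 i.2.2 * quad f i := by
    funext i
    rw [phaseKernel_decomposition]
    ring
  rw [e, h.tsum_eq, form]
  push_cast
  ring

end Time

/-! ### The space-time integral as a quartic form. -/

section SpaceTime

theorem summable_convolution {f : ℤ → ℂ} (hf : Summable fun n => ‖f n‖ ^ 2) (k : ℤ) :
    Summable fun n => ‖f n * f (k - n)‖ := by
  have hf' : Summable fun n => ‖f (k - n)‖ ^ 2 := (Equiv.subLeft k).summable_iff.2 hf
  refine (hf.add hf').of_nonneg_of_le (fun n => norm_nonneg _) fun n => ?_
  rw [norm_mul]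
  nlinarith [sq_nonneg (‖f n‖ - ‖f (k - n)‖), sq_nonneg ‖f n‖, sq_nonneg ‖f (k - n)‖]

/-- `(l, n, p) ↦ (2 n - l - p, n, n - l)` -/
def resonance : ℤ × ℤ × ℤ ≃ ℤ × ℤ × ℤ where
  toFun i := (2 * i.2.1 - i.1 - i.2.2, i.2.1, i.2.1 - i.1)
  invFun i := (i.2.1 - i.2.2, i.2.1, i.2.1 + i.2.2 - i.1)
  left_inv i := by ext <;> simp; ring
  right_inv i := by ext <;> simp; ring

/-- The phases at `n` and `m` differ through `n² + (k - n)² - m² - (k - m)² = 2 (n - m) (n + m -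
k)`, which is `2 l p` with `l = n - m` and `p = n + m - k`. -/
theorem tsum_integral_norm_sq {f : ℤ → ℂ} (hf : Summable fun n => ‖f n‖ ^ 2) :
    HasSum (fun k : ℤ => ∫ t in (0 : ℝ)..1,
      ‖∑' n : ℤ, Complex.exp (-Complex.I * ((Real.pi / 2 * (n ^ 2 + (k - n) ^ 2)) * t : ℝ)) *
        (f n * f (k - n))‖ ^ 2) (form phaseKernel f).re := by
  have h := (summable_form summable_weight weight_nonneg norm_phaseKernel_le hf).hasSum
  rw [← form.eq_def] at h
  have h2 : HasSum (fun i : ℤ × ℤ × ℤ => phaseKernel (i.2.1 - i.2.2) (i.2.1 + i.2.2 - i.1) *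
      (f i.2.1 * f (i.1 - i.2.1) * conj (f i.2.2 * f (i.1 - i.2.2)))) (form phaseKernel f) := by
    refine resonance.hasSum_iff.1 (hasSum_of_terms_eq h fun i => ?_)
    simp only [Function.comp, resonance, Equiv.coe_fn_mk, quad, map_mul]
    rw [show i.2.1 - (i.2.1 - i.1) = i.1 by ring,
      show i.2.1 + (i.2.1 - i.1) - (2 * i.2.1 - i.1 - i.2.2) = i.2.2 by ring,
      show 2 * i.2.1 - i.1 - i.2.2 - i.2.1 = i.2.1 - i.2.2 - i.1 by ring,
      show 2 * i.2.1 - i.1 - i.2.2 - (i.2.1 - i.1) = i.2.1 - i.2.2 by ring]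
    ring
  have h3 := h2.prod_fiberwise (fun k => (h2.summable.prod_factor k).hasSum)
  have h4 := Complex.hasSum_re h3
  refine hasSum_of_eq h4 (fun k => ?_) rfl
  have h5 := integral_norm_sq_tsum (summable_convolution hf k)
    (fun n => Real.pi / 2 * (n ^ 2 + (k - n) ^ 2))
  rw [← Complex.ofReal_re (∫ t in (0 : ℝ)..1, _), h5]
  congr 1
  refine tsum_congr fun i => ?_
  congr 1
  rw [phaseKernel]
  congr 1
  funext t
  congr 3
  push_cast
  ring

/-- The space-time integral as a quartic form in the Fourier coefficients. -/
theorem quarticIntegral_eq (u : L2per (√(8 * Real.pi))) :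
    quarticIntegral u = ENNReal.ofReal (√(8 * Real.pi) * (form phaseKernel (fourierCoeff u)).re) ∧
      0 ≤ (form phaseKernel (fourierCoeff u)).re := by
  set L := √(8 * Real.pi) with hL
  have hL0 : 0 < L := fact_sqrt_eight_pi_pos.out
  have hL2 : L ^ 2 = 8 * Real.pi := Real.sq_sqrt (by positivity)
  have hf := summable_sq_fourierCoeff u
  set f := fourierCoeff u with hfdef
  have h := tsum_integral_norm_sq hf
  have hnn : ∀ k : ℤ, 0 ≤ ∫ t in (0 : ℝ)..1,
      ‖∑' n : ℤ, Complex.exp (-Complex.I * ((Real.pi / 2 * (n ^ 2 + (k - n) ^ 2)) * t : ℝ)) *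
        (f n * f (k - n))‖ ^ 2 := fun k =>
    intervalIntegral.integral_nonneg zero_le_one fun t _ => by positivity
  refine ⟨?_, h.nonneg hnn⟩
  have hconv : ∀ (t : ℝ) (k : ℤ), ∑' n, fourierCoeff (schrodinger t u) n *
      fourierCoeff (schrodinger t u) (k - n) =
      ∑' n : ℤ, Complex.exp (-Complex.I * ((Real.pi / 2 * (n ^ 2 + (k - n) ^ 2)) * t : ℝ)) *
        (f n * f (k - n)) := by
    intro t k
    refine tsum_congr fun n => ?_
    rw [fourierCoeff_schrodinger, fourierCoeff_schrodinger, mul_mul_mul_comm, ← Complex.exp_add]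
    congr 2
    -- This is where `L ^ 2 = 8 * π` enters, giving `B = π / 2`.
    have e : ∀ m : ℝ, (2 * Real.pi * m / L) ^ 2 = Real.pi / 2 * m ^ 2 := fun m => by
      rw [div_pow, hL2]
      have := Real.pi_ne_zero
      field_simp
      ring
    rw [e, e, ← mul_add, ← Complex.ofReal_add]
    congr 2
    push_cast
    ring
  have hx : ∀ t : ℝ, ∫⁻ x : AddCircle L, ‖schrodinger t u x‖ₑ ^ 4 =
      ENNReal.ofReal L * ∑' k : ℤ, ‖∑' n : ℤ, Complex.exp (-Complex.I *
        ((Real.pi / 2 * (n ^ 2 + (k - n) ^ 2)) * t : ℝ)) * (f n * f (k - n))‖ₑ ^ 2 := by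
    intro t
    rw [volume_eq_smul_haarAddCircle, lintegral_smul_measure, lintegral_enorm_pow_four, smul_eq_mul]
    simp_rw [hconv]
  have hcont := fun k : ℤ => continuous_tsum_exp (summable_convolution hf k)
    (fun n => Real.pi / 2 * ((n : ℝ) ^ 2 + ((k : ℝ) - n) ^ 2))
  rw [quarticIntegral]
  refine (lintegral_congr hx).trans ?_
  rw [lintegral_const_mul' _ _ ENNReal.ofReal_ne_top, lintegral_tsum fun k =>
    ((hcont k).measurable.enorm.pow_const 2).aemeasurable, ENNReal.ofReal_mul hL0.le, ← h.tsum_eq,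
    ENNReal.ofReal_tsum_of_nonneg hnn h.summable]
  congr 1
  exact tsum_congr fun k => lintegral_enorm_sq_tsum (summable_convolution hf k) _

end SpaceTime

/-! ### Ground states and their symmetry. -/

section GroundStates

theorem power_eq {L : ℝ} [hL : Fact (0 < L)] (u : L2per L) :
    power u = L / 2 * mass (fourierCoeff u) := by
  rw [power, volume_eq_smul_haarAddCircle, integral_smul_measure, ENNReal.toReal_ofReal hL.out.le,
    mass, tsum_sq_fourierCoeff, smul_eq_mul]
  ring

theorem hamiltonian_eq (u : L2per (√(8 * Real.pi))) :
    hamiltonian u =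
      -(2 * Real.pi) * (2 * mass (fourierCoeff u) ^ 2 + (form kernel (fourierCoeff u)).re) := by
  obtain ⟨h, h0⟩ := quarticIntegral_eq u
  have hL0 : 0 < √(8 * Real.pi) := fact_sqrt_eight_pi_pos.out
  rw [hamiltonian, h, ENNReal.toReal_ofReal (mul_nonneg hL0.le h0),
    form_phaseKernel (summable_sq_fourierCoeff u), Complex.add_re, Complex.ofReal_re]
  field_simp

/-- Conjugation of the coefficient is undone by the substitution `x ↦ -x`. -/
theorem fourierCoeff_im_eq_zero {L : ℝ} [Fact (0 < L)] {u : L2per L} (hr : IsRealValued u)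
    (he : IsEven u) (n : ℤ) : (fourierCoeff u n).im = 0 := by
  rw [← Complex.conj_eq_iff_im, fourierCoeff, ← integral_conj,
    ← integral_neg_eq_self (fun t => fourier (-n) t • u t)]
  refine integral_congr_ae ?_
  filter_upwards [hr, he] with x h1 h2
  rw [smul_eq_mul, smul_eq_mul, map_mul, Complex.conj_eq_iff_im.2 h1, h2, ← fourier_neg, neg_neg]
  congr 1
  rw [fourier_apply, fourier_apply, smul_neg, neg_smul, neg_neg]

theorem mass_eq_of_power_eq {L lam : ℝ} [hL : Fact (0 < L)] {u : L2per L} (hu : power u = lam) :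
    mass (fourierCoeff u) = 2 * lam / L := by
  have := hL.out.ne'
  rw [← hu, power_eq]
  field_simp

/-- The unit maximizer is rescaled to the prescribed power, by homogeneity of degree 4. The strict
sign is kept for comparison with real even functions. -/
theorem exists_groundState {lam : ℝ} (hlam : 0 < lam) :
    ∃ φ ∈ groundStates (√(8 * Real.pi)) lam, 0 < (form kernel (fourierCoeff φ)).re := by
  obtain ⟨c, hc, hc1, hpos, hmax⟩ := exists_maximizer_kernel
  have hL0 : 0 < √(8 * Real.pi) := fact_sqrt_eight_pi_pos.out
  have hq : 0 < 2 * lam / √(8 * Real.pi) := by positivity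
  set r := √(2 * lam / √(8 * Real.pi)) with hr
  have hr2 : r ^ 2 = 2 * lam / √(8 * Real.pi) := Real.sq_sqrt hq.le
  obtain ⟨φ, hφ⟩ := exists_fourierCoeff_eq (L := √(8 * Real.pi)) (c := fun n => r * c n) (by
    simp only [norm_mul, mul_pow]
    exact hc.mul_left _)
  have hφ' : fourierCoeff φ = fun n => r * c n := funext hφ
  have hm : mass (fourierCoeff φ) = 2 * lam / √(8 * Real.pi) := by
    rw [hφ', mass_smul, hc1, hr2, mul_one]
  have hform : (form kernel (fourierCoeff φ)).re =
      (form kernel c).re * (2 * lam / √(8 * Real.pi)) ^ 2 := by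
    rw [hφ', form_smul, ← Complex.ofReal_pow, Complex.re_ofReal_mul, ← hr2]
    ring
  refine ⟨φ, ⟨?_, fun ψ hψ => ?_⟩, hform ▸ mul_pos hpos (pow_pos hq 2)⟩
  · rw [power_eq, hm]
    field_simp
  · have h := hmax (fourierCoeff ψ) (summable_sq_fourierCoeff ψ)
    rw [mass_eq_of_power_eq hψ, ← hform] at h
    rw [hamiltonian_eq, hamiltonian_eq, hm, mass_eq_of_power_eq hψ]
    nlinarith [Real.pi_pos]

theorem not_real_and_even {lam : ℝ} (hlam : 0 < lam) {φ : L2per (√(8 * Real.pi))}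
    (hφ : φ ∈ groundStates (√(8 * Real.pi)) lam) : ¬ (IsRealValued φ ∧ IsEven φ) := by
  rintro ⟨hr, he⟩
  have hle := re_form_kernel_nonpos (summable_sq_fourierCoeff φ) (fourierCoeff_im_eq_zero hr he)
  obtain ⟨ψ, hψ, hpos⟩ := exists_groundState hlam
  have h := hφ.2 ψ hψ.1
  rw [hamiltonian_eq, hamiltonian_eq, mass_eq_of_power_eq hψ.1, mass_eq_of_power_eq hφ.1] at h
  nlinarith [Real.pi_pos]

end GroundStates

/-! ### The functional `A` on real Fourier coefficients. -/

section RealCoefficients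

theorem dTerm_eq (u : L2per (2 * Real.pi)) (i : ℤ × ℤ × ℤ) :
    dTerm (Real.pi / 2) u i =
      (Real.pi / 2 : ℂ) * (oddKernel i.1 i.2.2 * quad (fourierCoeff u) i) := by
  rw [dTerm]
  split_ifs with h
  -- Zero is not odd, so the terms left out of `dTerm` also vanish for `oddKernel`.
  · rcases h with h | h <;> simp [oddKernel, h]
  · push Not at h
    have hpi : (Real.pi : ℂ) ≠ 0 := Complex.ofReal_ne_zero.2 Real.pi_ne_zero
    have hl' : (i.1 : ℂ) ≠ 0 := Int.cast_ne_zero.2 h.1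
    have hp' : (i.2.2 : ℂ) ≠ 0 := Int.cast_ne_zero.2 h.2
    have hc : -2 * Complex.I * i.1 * i.2.2 ≠ 0 :=
      mul_ne_zero (mul_ne_zero (mul_ne_zero (by norm_num) Complex.I_ne_zero) hl') hp'
    have h1 : ∫ t in (0 : ℝ)..(Real.pi / 2), Complex.exp (-2 * Complex.I * i.1 * i.2.2 * t) =
        Real.pi / 2 * oddKernel i.1 i.2.2 := by
      rw [integral_exp_mul_complex hc, ← exp_sub_one_div h.1 h.2, Complex.ofReal_zero, mul_zero,
        Complex.exp_zero, show -2 * Complex.I * i.1 * i.2.2 * ((Real.pi / 2 : ℝ) : ℂ) =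
          -Complex.I * (Real.pi * (i.1 * i.2.2 : ℤ) : ℝ) by push_cast; ring]
      push_cast
      field_simp
    rw [h1, quad]
    ring

theorem summable_dTerm (u : L2per (2 * Real.pi)) : Summable (dTerm (Real.pi / 2) u) := by
  rw [show dTerm (Real.pi / 2) u = _ from funext (dTerm_eq u)]
  exact (summable_form summable_weight weight_nonneg norm_oddKernel_le
    (summable_sq_fourierCoeff u)).mul_left _

theorem aFunctional_eq {u : L2per (2 * Real.pi)} (hu : ∀ n, (fourierCoeff u n).im = 0) :
    aFunctional (Real.pi / 2) u = ((-l4pow u : ℝ) : ℂ) := by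
  have h : ∑' i, dTerm (Real.pi / 2) u i = 0 := by
    rw [tsum_congr (dTerm_eq u), tsum_mul_left, ← form.eq_def, form_oddKernel_eq_zero hu, mul_zero]
  rw [aFunctional, dFunctional, h]
  simp

theorem l4pow_pos {u : L2per (2 * Real.pi)} (hu : u ≠ 0) : 0 < l4pow u := by
  have hf := summable_sq_fourierCoeff u
  -- Summability must be checked: a divergent `tsum` would be 0 and strict positivity would fail.
  have hs : Summable fun n => ‖fourierCoeff u n‖ ^ 4 := by
    refine (hf.mul_left (mass (fourierCoeff u))).of_nonneg_of_le (fun n => by positivity) fun n => ?_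
    have h := mul_le_mul_of_nonneg_right (sq_le_mass hf n) (sq_nonneg ‖fourierCoeff u n‖)
    calc ‖fourierCoeff u n‖ ^ 4 = ‖fourierCoeff u n‖ ^ 2 * ‖fourierCoeff u n‖ ^ 2 := by ring
      _ ≤ _ := h
  obtain ⟨n, hn⟩ : ∃ n, fourierCoeff u n ≠ 0 := by
    by_contra hcon
    push Not at hcon
    refine hu (fourierBasis.repr.injective ?_)
    ext n
    rw [fourierBasis_repr, hcon, map_zero]
    rfl
  exact hs.tsum_pos (fun n => by positivity) n (pow_pos (norm_pos_iff.2 hn) 4)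

end RealCoefficients

end PeriodicDMNLS

end

theorem mainTheorem7 :
    (2 * Real.pi / √(8 * Real.pi)) ^ 2 = Real.pi / 2 ∧
    (∀ u : PeriodicDMNLS.L2per (√(8 * Real.pi)), PeriodicDMNLS.quarticIntegral u < ⊤) ∧
    (∀ lam : ℝ, 0 < lam →
      (PeriodicDMNLS.groundStates (√(8 * Real.pi)) lam).Nonempty ∧
      ∀ φ ∈ PeriodicDMNLS.groundStates (√(8 * Real.pi)) lam,
        ¬ (PeriodicDMNLS.IsRealValued φ ∧ PeriodicDMNLS.IsEven φ)) ∧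
    (∀ u : PeriodicDMNLS.L2per (2 * Real.pi), u ≠ 0 →
      (∀ n : ℤ, (fourierCoeff u n).im = 0) →
      Summable (PeriodicDMNLS.dTerm (Real.pi / 2) u) ∧
      PeriodicDMNLS.aFunctional (Real.pi / 2) u = ((-PeriodicDMNLS.l4pow u : ℝ) : ℂ) ∧
      -PeriodicDMNLS.l4pow u < 0) := by
  refine ⟨?_, fun u => ?_, fun lam hlam => ⟨?_,
    fun φ hφ => PeriodicDMNLS.not_real_and_even hlam hφ⟩, fun u hu hc =>
    ⟨PeriodicDMNLS.summable_dTerm u, PeriodicDMNLS.aFunctional_eq hc,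
      neg_neg_of_pos (PeriodicDMNLS.l4pow_pos hu)⟩⟩
  · rw [div_pow, Real.sq_sqrt (by positivity)]
    have := Real.pi_ne_zero
    field_simp
    norm_num
  · rw [(PeriodicDMNLS.quarticIntegral_eq u).1]
    exact ENNReal.ofReal_lt_top
  · obtain ⟨φ, hφ, -⟩ := PeriodicDMNLS.exists_groundState hlam
    exact ⟨φ, hφ⟩
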